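/- Let $H$ be a real Hilbert space, $m\ge 1$, let $f_1,\dots,f_m:H\to(-\infty,+\infty]$ be proper, convex and lower semicontinuous, and let $h,g:H\to\mathbb R$ be convex and (Fréchet) differentiable, with gradients $\nabla h$ and $\nabla g$ Lipschitz continuous with constants $L_h\ge 0$ and $L_g>0$, respectively. Assume that $\operatorname{argmin} g\neq\emptyset$ and $\min g=0$, and that the set $\mathcal S$ of solutions of $$\text{minimize } \sum_{i=1}^m f_i(x)+h(x)\quad\text{subject to } x\in\operatorname{argmin} g$$ is nonempty. Let $(\alpha_k)_{k\ge1}$, $(\beta_k)_{k\ge1}$ be sequences of positive reals, let $x_1\in H$ be arbitrary, and for $k\ge 1$ let $$\psi_{0,k}=x_k-\alpha_k\nabla h(x_k)-\alpha_k\beta_k\nabla g(x_k),\qquad \psi_{i,k}=\operatorname{prox}_{\alpha_k f_i}(\psi_{i-1,k})\ (i=1,\dots,m),\qquad x_{k+1}=\psi_{m,k},$$ where $\operatorname{prox}_{rf}(x)$ is the unique minimizer of $u\mapsto f(u)+\frac1{2r}\|u-x\|^2$. Put $z_k=\frac1{\tau_k}\sum_{n=1}^k\alpha_nx_n$ with $\tau_k=\sum_{n=1}^k\alpha_n$.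 For a set $X\subseteq H$, let $\sigma_X(p)=\sup_{z\in X}\langle p,z\rangle$, let $N_X(x)=\{p\in H:\langle p,z-x\rangle\le 0\text{ for all }z\in X\}$ for $x\in X$ and $N_X(x)=\emptyset$ for $x\notin X$, and let $\operatorname{ran}(N_X)=\bigcup_{x\in H}N_X(x)$. Let $g^*(p)=\sup_{u\in H}(\langle p,u\rangle-g(u))$. For $f:H\to(-\infty,+\infty]$, let $\partial f$ be its convex subdifferential (empty where $f=+\infty$) and $\operatorname{dom}(\partial f)=\{x:\partial f(x)\neq\emptyset\}$. Assume: (S1) $\operatorname{argmin} g\cap\bigcap_{i=1}^m\operatorname{int}(\operatorname{dom}(\partial f_i))\neq\emptyset$; (S2) for every $p\in\operatorname{ran}(N_{\operatorname{argmin} g})$, $\ \sum_{k=1}^\infty\alpha_k\beta_k\left[g^*\left(\frac p{\beta_k}\right)-\sigma_{\operatorname{argmin} g}\left(\frac p{\beta_k}\right)\right]<+\infty$; (S3) $0<\liminf_{k\to\infty}\alpha_k\beta_k\le\limsup_{k\to\infty}\alpha_k\beta_k<\frac1{L_g}$; (S4) $(\alpha_k)_{k\ge1}\in\ell^2\setminus\ell^1$.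 Then the sequence $(z_k)_{k\ge1}$ converges weakly to an element of $\mathcal S$. -/

import Mathlib

open Filter Topology
open scoped NNReal ENNReal

noncomputable section

namespace HierMin

variable {H : Type*} [NormedAddCommGroup H] [InnerProductSpace ℝ H]

/-- A function `f : H → [-∞, +∞]` is proper: it never takes the value `-∞`, and it is not
identically `+∞`. -/
def Proper (f : H → EReal) : Prop :=
  (∀ x, f x ≠ ⊥) ∧ ∃ x, f x ≠ ⊤

/-- Convexity of an extended-real-valued function (used for functions that never take the
value `-∞`). -/
def ConvexFun (f : H → EReal) : Prop :=
  ∀ x y : H, ∀ a b : ℝ, 0 < a → 0 < b → a + b = 1 →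
    f (a • x + b • y) ≤ (a : EReal) * f x + (b : EReal) * f y

/-- The set of (global) minimizers of `g : H → ℝ`. -/
def argmin (g : H → ℝ) : Set H :=
  {x | ∀ y, g x ≤ g y}

/-- The subdifferential of `f` at `x`; it is empty where `f` is not finite. -/
def subdiff (f : H → EReal) (x : H) : Set H :=
  {v | f x ≠ ⊥ ∧ f x ≠ ⊤ ∧ ∀ y, f x + ((inner ℝ v (y - x) : ℝ) : EReal) ≤ f y}

/-- The domain of the set-valued operator `∂f`. -/
def domSubdiff (f : H → EReal) : Set H :=
  {x | (subdiff f x).Nonempty}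

/-- The normal cone to `X` at `x`; it is empty if `x ∉ X`. -/
def normalCone (X : Set H) (x : H) : Set H :=
  {v | x ∈ X ∧ ∀ z ∈ X, inner ℝ v (z - x) ≤ 0}

/-- The range of the set-valued operator `x ↦ N_X(x)`. -/
def ranNormalCone (X : Set H) : Set H :=
  {v | ∃ x, v ∈ normalCone X x}

/-- The Fenchel conjugate `f*(p) = sup_u (⟨p, u⟩ - f(u))`. -/
def conj (f : H → EReal) (p : H) : EReal :=
  ⨆ u : H, (((inner ℝ p u : ℝ) : EReal) - f u)

/-- The support function `σ_X(p) = sup_{z ∈ X} ⟨p, z⟩`. -/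
def supportFun (X : Set H) (p : H) : EReal :=
  ⨆ z ∈ X, ((inner ℝ p z : ℝ) : EReal)

/-- `p` is a proximal point `prox_{r f}(x)`, that is, a minimizer of
`u ↦ f(u) + ‖u - x‖² / (2 r)`. (For `r > 0` and `f` proper, convex and lower semicontinuous, there
is exactly one.) -/
def IsProx (r : ℝ) (f : H → EReal) (x p : H) : Prop :=
  ∀ u : H, f p + ((1 / (2 * r) * ‖p - x‖ ^ 2 : ℝ) : EReal)
    ≤ f u + ((1 / (2 * r) * ‖u - x‖ ^ 2 : ℝ) : EReal)

/-- The set of solutions of: minimize `∑ i, f i x + h x` subject to `x ∈ argmin g`. -/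
def solutions {m : ℕ} (f : Fin m → H → EReal) (h g : H → ℝ) : Set H :=
  {x | x ∈ argmin g ∧ ∀ y ∈ argmin g,
    (∑ i, f i x) + ((h x : ℝ) : EReal) ≤ (∑ i, f i y) + ((h y : ℝ) : EReal)}

/-- The sequence `x 1, x 2, …` is generated by the incremental proximal gradient algorithm with
penalty; `ψ k i` is the `i`-th inner iterate at step `k`. The values at `k = 0` play no role. -/
structure IsGenerated [CompleteSpace H] {m : ℕ} (f : Fin m → H → EReal) (h g : H → ℝ)
    (α β : ℕ → ℝ) (x : ℕ → H) (ψ : ℕ → ℕ → H) : Prop where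
  start : ∀ k, 1 ≤ k →
    ψ k 0 = x k - α k • gradient h (x k) - (α k * β k) • gradient g (x k)
  step : ∀ k, 1 ≤ k → ∀ i : Fin m, IsProx (α k) (f i) (ψ k i) (ψ k (i + 1))
  next : ∀ k, 1 ≤ k → x (k + 1) = ψ k m

/-- The weighted averages `z_k = (∑_{n=1}^k α_n x_n) / (∑_{n=1}^k α_n)`. -/
def weightedAvg (α : ℕ → ℝ) (x : ℕ → H) (k : ℕ) : H :=
  (∑ n ∈ Finset.Icc 1 k, α n)⁻¹ • ∑ n ∈ Finset.Icc 1 k, α n • x n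

/-- The bracket `g*(p/b) - σ_{argmin g}(p/b)`, weighted by `a * b`, as an element of `[0, +∞]`.
If `min g = 0`, the bracket is nonnegative, so that nothing is cut off by `toENNReal`. -/
def penaltyTerm (g : H → ℝ) (a b : ℝ) (p : H) : ℝ≥0∞ :=
  (((a * b : ℝ) : EReal) *
    (conj (fun u => ((g u : ℝ) : EReal)) (b⁻¹ • p) - supportFun (argmin g) (b⁻¹ • p))).toENNReal

end HierMin

end

/-! Fix a solution `u`. Under (S1) the sum rule gives subgradients `v i` of `f i` and `v₀` of `h` at
`u` such that `p = -(∑ v i + v₀)` is normal to `argmin g` at `u` (`exists_subgradients_of_isMin`).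
One iteration changes `‖x - u‖²` by `2α⟨p, x - u⟩ - αβ g(x)`, by negative terms (a further `αβ
g(x)`, the squared inner steps, `‖∇g(x)‖²`) and by errors of order `α²` (`fejer_step`).
Fenchel–Young bounds the first expression by the penalty term of `2p` (`penaltyTerm_ge`), which is
summable by (S2). A Robbins–Siegmund argument then shows that `‖x_k - u‖` converges, `g(x_k) → 0`,
and all inner iterates approach `x_k`.

For the averages, the one-step inequality is summed against any `y ∈ argmin g` with finite objective
and divided by `τ_k → ∞`. Jensen's inequality and weak lower semicontinuity show that every weak
cluster point of `z_k` is a solution (`IsRun.mem_solutions`). Convergence of the distances to all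
solutions allows only one cluster point (`tendsto_avg_weakly`). -/

namespace HierMin


/-! ### Scalar recursions. -/

section Algebra

theorem nonneg_of_forall_add_mul_nonneg {s N : ℝ} (hN : 0 ≤ N)
    (hs : ∀ t : ℝ, 0 < t → t < 1 → 0 ≤ s + t * N) : 0 ≤ s := by
  by_contra hneg
  push Not at hneg
  have hD : 0 < -s + N + 1 := by linarith
  have := hs (-s / (-s + N + 1)) (div_pos (by linarith) hD) ((div_lt_one hD).2 (by linarith))
  rw [div_mul_eq_mul_div, ← sub_nonneg, sub_zero] at this
  have h2 : -s * N / (-s + N + 1) < -s := by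
    rw [div_lt_iff₀ hD]; nlinarith
  linarith

/-- A deterministic Robbins–Siegmund lemma with additive perturbations. -/
theorem tendsto_and_summable_of_le_add {A e D : ℕ → ℝ} (hA : ∀ n, 0 ≤ A n) (he : ∀ n, 0 ≤ e n)
    (hD : ∀ n, 0 ≤ D n) (hDs : Summable D) (hstep : ∀ n, A (n + 1) + e n ≤ A n + D n) :
    (∃ l, Tendsto A atTop (𝓝 l)) ∧ Summable e := by
  have hsum : ∀ n, A n + ∑ i ∈ Finset.range n, e i ≤ A 0 + ∑ i ∈ Finset.range n, D i := by
    intro n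
    induction n with
    | zero => simp
    | succ n ih =>
      rw [Finset.sum_range_succ, Finset.sum_range_succ]
      linarith [hstep n]
  have hDle : ∀ n, ∑ i ∈ Finset.range n, D i ≤ ∑' i, D i :=
    fun n => hDs.sum_le_tsum _ fun i _ => hD i
  have hes : Summable e :=
    summable_of_sum_range_le (c := A 0 + ∑' i, D i) he fun n => by
      linarith [hsum n, hDle n, hA n]
  refine ⟨?_, hes⟩
  -- `B` corrects `A` by the accumulated gains and losses, so it is antitone and bounded below.
  set B : ℕ → ℝ := fun n => A n + ∑ i ∈ Finset.range n, e i - ∑ i ∈ Finset.range n, D i with hB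
  have hanti : Antitone B := antitone_nat_of_succ_le fun n => by
    simp only [hB, Finset.sum_range_succ]
    linarith [hstep n]
  have hbdd : BddBelow (Set.range B) := by
    refine ⟨-∑' i, D i, ?_⟩
    rintro _ ⟨n, rfl⟩
    have := Finset.sum_nonneg (s := Finset.range n) fun i _ => he i
    simp only [hB]
    linarith [hA n, hDle n]
  have h1 := tendsto_atTop_ciInf hanti hbdd
  refine ⟨_, ((h1.sub hes.hasSum.tendsto_sum_nat).add hDs.hasSum.tendsto_sum_nat).congr
    fun n => ?_⟩
  simp only [hB]
  ring

/-- A deterministic Robbins–Siegmund lemma. -/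
theorem tendsto_and_summable_of_le_mul_add {A e c D : ℕ → ℝ} (hA : ∀ n, 0 ≤ A n)
    (he : ∀ n, 0 ≤ e n) (hc : ∀ n, 0 ≤ c n) (hcs : Summable c) (hD : ∀ n, 0 ≤ D n)
    (hDs : Summable D) (hstep : ∀ n, A (n + 1) + e n ≤ (1 + c n) * A n + D n) :
    (∃ l, Tendsto A atTop (𝓝 l)) ∧ Summable e := by
  -- A discrete Grönwall bound makes `A` bounded by some `M`; then `c n * A n ≤ c n * M` is a
  -- summable additive perturbation.
  have hbound : ∀ n, A n ≤ Real.exp (∑ i ∈ Finset.range n, c i) *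
      (A 0 + ∑ i ∈ Finset.range n, D i) := by
    intro n
    induction n with
    | zero => simp
    | succ n ih =>
      rw [Finset.sum_range_succ, Finset.sum_range_succ, Real.exp_add]
      have h1 : 1 + c n ≤ Real.exp (c n) := by linarith [Real.add_one_le_exp (c n)]
      have hE : 0 < Real.exp (∑ i ∈ Finset.range n, c i) := Real.exp_pos _
      have hE1 : 1 ≤ Real.exp (∑ i ∈ Finset.range n, c i) :=
        Real.one_le_exp (Finset.sum_nonneg fun i _ => hc i)
      have hE2 : 1 ≤ Real.exp (c n) := Real.one_le_exp (hc n)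
      have h2 : (1 + c n) * A n ≤ Real.exp (c n) * A n := mul_le_mul_of_nonneg_right h1 (hA n)
      have h3 := mul_le_mul_of_nonneg_left ih (Real.exp_pos (c n)).le
      have h4 : D n ≤ Real.exp (∑ i ∈ Finset.range n, c i) * Real.exp (c n) * D n :=
        le_mul_of_one_le_left (hD n) (one_le_mul_of_one_le_of_one_le hE1 hE2)
      nlinarith [hstep n, he n]
  set M : ℝ := Real.exp (∑' i, c i) * (A 0 + ∑' i, D i) with hM
  have hAM : ∀ n, A n ≤ M := fun n => (hbound n).trans <| by
    have h0 : 0 ≤ ∑ i ∈ Finset.range n, D i := Finset.sum_nonneg fun i _ => hD i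
    refine mul_le_mul (Real.exp_le_exp.2 (hcs.sum_le_tsum _ fun i _ => hc i)) ?_
      (by linarith [hA 0]) (Real.exp_pos _).le
    linarith [hDs.sum_le_tsum (Finset.range n) fun i _ => hD i]
  have hM0 : 0 ≤ M := (hA 0).trans (hAM 0)
  refine tendsto_and_summable_of_le_add (D := fun n => c n * M + D n) hA he
    (fun n => add_nonneg (mul_nonneg (hc n) hM0) (hD n)) ((hcs.mul_right M).add hDs) fun n => ?_
  nlinarith [hstep n, mul_le_mul_of_nonneg_left (hAM n) (hc n)]

end Algebra

/-! ### Proximal steps. -/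

section Prox

theorem IsProx.exists_real {H : Type*} [NormedAddCommGroup H] {f : H → EReal} (hf : Proper f) {r : ℝ} {x p : H}
    (hp : IsProx r f x p) : ∃ φ : ℝ, f p = φ := by
  obtain ⟨u, hu⟩ := hf.2
  lift f u to ℝ using ⟨hu, hf.1 u⟩ with w hw
  have h1 := hp u
  rw [← hw] at h1
  have : f p ≠ ⊤ := by
    intro htop
    rw [htop, EReal.top_add_coe] at h1
    exact absurd h1 (not_le.2 (by rw [← EReal.coe_add]; exact EReal.coe_lt_top _))
  exact ⟨(f p).toReal, (EReal.coe_toReal this (hf.1 p)).symm⟩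

variable {H : Type*} [NormedAddCommGroup H] [InnerProductSpace ℝ H]

/-- Compare the minimizer `p` with the nearby point `p + t(u - p)`, divide by `t` and let `t → 0`:
this is the variational inequality of the prox, rewritten with squared norms. -/
theorem IsProx.norm_sq_le {f : H → EReal} (hf : ConvexFun f) {r : ℝ} (hr : 0 < r) {x p u : H}
    (hp : IsProx r f x p) {φ w : ℝ} (hφ : f p = φ) (hw : f u = w) :
    ‖p - u‖ ^ 2 + ‖p - x‖ ^ 2 ≤ ‖x - u‖ ^ 2 + 2 * r * (w - φ) := by
  have key : ∀ t : ℝ, 0 < t → t < 1 →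
      0 ≤ (2 * r * (w - φ) + 2 * inner ℝ (p - x) (u - p)) + t * ‖u - p‖ ^ 2 := by
    intro t ht0 ht1
    have h1 := (hp ((1 - t) • p + t • u)).trans
      (add_le_add_left (hf p u (1 - t) t (by linarith) ht0 (by ring)) _)
    rw [hφ, hw] at h1
    norm_cast at h1
    have h2 : (1 - t) • p + t • u - x = (p - x) + t • (u - p) := by module
    rw [h2, norm_add_sq_real, inner_smul_right, norm_smul, mul_pow, Real.norm_eq_abs, sq_abs] at h1
    have h3 : 0 ≤ t * (w - φ) + 1 / (2 * r) * (2 * (t * inner ℝ (p - x) (u - p))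
        + t ^ 2 * ‖u - p‖ ^ 2) := by linarith
    have h4 : 0 ≤ 2 * r / t * (t * (w - φ) + 1 / (2 * r) * (2 * (t * inner ℝ (p - x) (u - p))
        + t ^ 2 * ‖u - p‖ ^ 2)) := by positivity
    convert h4 using 1
    field_simp
    ring
  have h5 := nonneg_of_forall_add_mul_nonneg (sq_nonneg _) key
  have h6 : x - u = -((p - x) + (u - p)) := by abel
  rw [h6, norm_neg, norm_add_sq_real, norm_sub_rev u p]
  linarith

theorem prox_chain_norm_sq_le {m : ℕ} {f : Fin m → H → EReal} (hf : ∀ i, ConvexFun (f i)) {r : ℝ}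
    (hr : 0 < r) {ψ : ℕ → H} (hψ : ∀ i : Fin m, IsProx r (f i) (ψ i) (ψ (i + 1))) {u : H}
    {φ w : Fin m → ℝ} (hφ : ∀ i : Fin m, f i (ψ (i + 1)) = φ i) (hw : ∀ i, f i u = w i) :
    ‖ψ m - u‖ ^ 2 + ∑ i : Fin m, ‖ψ (i + 1) - ψ i‖ ^ 2
      ≤ ‖ψ 0 - u‖ ^ 2 + 2 * r * ∑ i, (w i - φ i) := by
  have h1 : ∀ i : Fin m, (‖ψ (i + 1) - u‖ ^ 2 - ‖ψ i - u‖ ^ 2) + ‖ψ (i + 1) - ψ i‖ ^ 2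
      ≤ 2 * r * (w i - φ i) := fun i => by
    linarith [(hψ i).norm_sq_le (hf i) hr (hφ i) (hw i)]
  have h2 := Finset.sum_le_sum fun i (_ : i ∈ Finset.univ) => h1 i
  rw [Finset.sum_add_distrib, ← Finset.mul_sum,
    Fin.sum_univ_eq_sum_range (fun i => ‖ψ (i + 1) - u‖ ^ 2 - ‖ψ i - u‖ ^ 2),
    Finset.sum_range_sub (fun i => ‖ψ i - u‖ ^ 2)] at h2
  linarith

end Prox

/-! ### Smooth convex functions and the gradient step. -/

section Smooth

variable {H : Type*} [NormedAddCommGroup H] [InnerProductSpace ℝ H] [CompleteSpace H]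

theorem hasDerivAt_comp_line {g : H → ℝ} (hg : Differentiable ℝ g) (x d : H) (t : ℝ) :
    HasDerivAt (fun s : ℝ => g (x + s • d)) (inner ℝ (gradient g (x + t • d)) d) t := by
  have h1 : HasDerivAt (fun s : ℝ => x + s • d) d t := by
    simpa using ((hasDerivAt_id t).smul_const d).const_add x
  have h2 := (hg (x + t • d)).hasFDerivAt.comp_hasDerivAt t h1
  rwa [inner_gradient_left]

theorem add_inner_gradient_le {g : H → ℝ} (hc : ConvexOn ℝ Set.univ g) (hg : Differentiable ℝ g)
    (x y : H) : g x + inner ℝ (gradient g x) (y - x) ≤ g y := by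
  have hd := hasDerivAt_comp_line hg x (y - x) 0
  have hconv : ConvexOn ℝ Set.univ (fun s : ℝ => g (x + s • (y - x))) := by
    have := hc.comp_affineMap (AffineMap.lineMap x y)
    rw [Set.preimage_univ] at this
    have e : (fun s : ℝ => g (x + s • (y - x))) = g ∘ AffineMap.lineMap x y := by
      ext s
      simp [AffineMap.lineMap_apply, add_comm]
    rwa [e]
  have h1 := hconv.le_slope_of_hasDerivAt (Set.mem_univ 0) (Set.mem_univ 1) one_pos hd
  simp only [slope, sub_zero, inv_one, one_smul, zero_smul, add_zero, vsub_eq_sub,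
    add_sub_cancel] at h1
  linarith

/-- Descent lemma: along the ray from `x` through `y`, the linearization error minus its quadratic
bound has nonpositive derivative by the Lipschitz estimate. -/
theorem le_add_inner_gradient_add_sq {g : H → ℝ} (hg : Differentiable ℝ g) {L : ℝ≥0}
    (hL : LipschitzWith L (gradient g)) (x y : H) :
    g y ≤ g x + inner ℝ (gradient g x) (y - x) + L / 2 * ‖y - x‖ ^ 2 := by
  set d := y - x with hd
  have hder : ∀ t : ℝ, HasDerivAt (fun s : ℝ => g (x + s • d) - s * inner ℝ (gradient g x) d
      - L / 2 * ‖d‖ ^ 2 * s ^ 2)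
      (inner ℝ (gradient g (x + t • d)) d - inner ℝ (gradient g x) d - L * ‖d‖ ^ 2 * t) t := by
    intro t
    have := ((hasDerivAt_comp_line hg x d t).sub
      ((hasDerivAt_id t).mul_const (inner ℝ (gradient g x) d))).sub
      ((hasDerivAt_pow 2 t).const_mul (L / 2 * ‖d‖ ^ 2))
    refine this.congr_deriv ?_
    push_cast
    ring
  have hanti := antitoneOn_of_deriv_nonpos (convex_Ici (0 : ℝ))
    (f := fun s : ℝ => g (x + s • d) - s * inner ℝ (gradient g x) d
      - L / 2 * ‖d‖ ^ 2 * s ^ 2)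
    (fun t _ => (hder t).continuousAt.continuousWithinAt)
    (fun t _ => (hder t).differentiableAt.differentiableWithinAt) (fun t ht => by
      rw [interior_Ici] at ht
      have ht0 : 0 < t := ht
      rw [(hder t).deriv, ← inner_sub_left]
      have h1 := real_inner_le_norm (gradient g (x + t • d) - gradient g x) d
      have h2 := hL.norm_sub_le (x + t • d) x
      rw [add_sub_cancel_left, norm_smul, Real.norm_of_nonneg ht0.le] at h2
      nlinarith [norm_nonneg d])
  have := hanti (Set.mem_Ici.2 le_rfl) (Set.mem_Ici.2 zero_le_one) zero_le_one
  simp only [one_smul, one_mul, one_pow, mul_one, zero_smul, add_zero, zero_mul, hd,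
    add_sub_cancel] at this
  rw [← hd] at this
  have h0 : (L : ℝ) / 2 * ‖d‖ ^ 2 * 0 ^ 2 = 0 := by ring
  linarith

theorem gradient_eq_zero_of_mem_argmin {g : H → ℝ} {u : H} (hu : u ∈ argmin g) :
    gradient g u = 0 := by
  have : IsLocalMin g u := Filter.Eventually.of_forall hu
  rw [gradient, this.fderiv_eq_zero, map_zero]

/-- Evaluate `g` at `u + L⁻¹∇g(x)`: the tangent at `x` bounds it from below, the descent lemma at
the minimizer `u` from above. The squared gradient gained here pays for the explicit step. -/
theorem sq_norm_gradient_le {g : H → ℝ} (hc : ConvexOn ℝ Set.univ g) (hg : Differentiable ℝ g)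
    {L : ℝ≥0} (hL0 : 0 < L) (hL : LipschitzWith L (gradient g)) {u : H} (hu : u ∈ argmin g)
    (x : H) :
    g x + ‖gradient g x‖ ^ 2 / (2 * L) ≤ g u + inner ℝ (gradient g x) (x - u) := by
  set v := gradient g x with hv
  have hL' : (0 : ℝ) < L := hL0
  have h1 := add_inner_gradient_le hc hg x (u + (L : ℝ)⁻¹ • v)
  have h2 := le_add_inner_gradient_add_sq hg hL u (u + (L : ℝ)⁻¹ • v)
  rw [gradient_eq_zero_of_mem_argmin hu, inner_zero_left, add_sub_cancel_left, norm_smul,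
    Real.norm_of_nonneg (inv_nonneg.2 hL'.le)] at h2
  have h3 : inner ℝ v (u + (L : ℝ)⁻¹ • v - x) = (L : ℝ)⁻¹ * ‖v‖ ^ 2 - inner ℝ v (x - u) := by
    rw [show u + (L : ℝ)⁻¹ • v - x = (L : ℝ)⁻¹ • v - (x - u) by abel, inner_sub_right,
      inner_smul_right, real_inner_self_eq_norm_sq]
  rw [← hv, h3] at h1
  have h4 : (L : ℝ) / 2 * ((L : ℝ)⁻¹ * ‖v‖) ^ 2 = ‖v‖ ^ 2 / (2 * L) := by field_simp
  have h5 : (L : ℝ)⁻¹ * ‖v‖ ^ 2 = 2 * (‖v‖ ^ 2 / (2 * L)) := by field_simp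
  linarith

/-- The effect of one explicit gradient step on the distance to a minimizer of the penalty. -/
theorem gradient_step_norm_sq_le {h g : H → ℝ} (hh : ConvexOn ℝ Set.univ h)
    (hhd : Differentiable ℝ h) (hc : ConvexOn ℝ Set.univ g) (hg : Differentiable ℝ g) {L : ℝ≥0}
    (hL0 : 0 < L) (hL : LipschitzWith L (gradient g)) {u : H} (hu : u ∈ argmin g)
    (hgu : g u = 0) {a s q ε : ℝ} (ha : 0 < a) (hs : 0 < s) (hsq : s ≤ q) (hε : 0 < ε) (x : H) :
    ‖x - a • gradient h x - s • gradient g x - u‖ ^ 2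
        + 2 * s * g x + s * (1 / L - (1 + ε) * q) * ‖gradient g x‖ ^ 2
      ≤ ‖x - u‖ ^ 2 + 2 * a * (h u - h x) + (1 + 1 / ε) * a ^ 2 * ‖gradient h x‖ ^ 2 := by
  set v := gradient g x with hv
  set y := gradient h x with hy
  have h1 := sq_norm_gradient_le hc hg hL0 hL hu x
  have h2 := add_inner_gradient_le hh hhd x u
  rw [← neg_sub x u, inner_neg_right] at h2
  rw [hgu] at h1
  rw [← hy] at h2
  rw [← hv] at h1
  have h3 : x - a • y - s • v - u = (x - u) - (a • y + s • v) := by abel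
  have h4 : ‖x - a • y - s • v - u‖ ^ 2 = ‖x - u‖ ^ 2 - 2 * a * inner ℝ y (x - u)
      - 2 * s * inner ℝ v (x - u)
      + (a ^ 2 * ‖y‖ ^ 2 + 2 * a * s * inner ℝ y v + s ^ 2 * ‖v‖ ^ 2) := by
    rw [h3, norm_sub_sq_real, norm_add_sq_real, inner_add_right, inner_smul_right,
      inner_smul_right, inner_smul_left, inner_smul_right, norm_smul, norm_smul, mul_pow, mul_pow,
      Real.norm_eq_abs, Real.norm_eq_abs, sq_abs, sq_abs, real_inner_comm y, real_inner_comm v]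
    simp
    ring
  -- Young's inequality with a free weight `ε`, so that the gap between `q` and `1 / L` can later
  -- decide how much of `‖∇g‖²` to spend.
  have h5 : 2 * a * s * inner ℝ y v ≤ 1 / ε * (a ^ 2 * ‖y‖ ^ 2) + ε * (s ^ 2 * ‖v‖ ^ 2) := by
    have h6 := real_inner_le_norm y v
    have h7 : 2 * (a * ‖y‖) * (s * ‖v‖) ≤ 1 / ε * (a * ‖y‖) ^ 2 + ε * (s * ‖v‖) ^ 2 := by
      have : 0 ≤ (1 / ε) * (a * ‖y‖ - ε * (s * ‖v‖)) ^ 2 := by positivity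
      have e : (1 / ε) * (a * ‖y‖ - ε * (s * ‖v‖)) ^ 2 = 1 / ε * (a * ‖y‖) ^ 2
        - 2 * (a * ‖y‖) * (s * ‖v‖) + ε * (s * ‖v‖) ^ 2 := by
        field_simp
        ring
      linarith
    have h8 : 2 * a * s * inner ℝ y v ≤ 2 * a * s * (‖y‖ * ‖v‖) :=
      mul_le_mul_of_nonneg_left h6 (by positivity)
    linarith [mul_pow a ‖y‖ 2, mul_pow s ‖v‖ 2]
  have h9 : (1 + ε) * s ^ 2 * ‖v‖ ^ 2 ≤ (1 + ε) * (s * q) * ‖v‖ ^ 2 := by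
    have : s ^ 2 ≤ s * q := by nlinarith
    gcongr
  have h10 : s * (‖v‖ ^ 2 / (2 * L)) * 2 = s * (1 / L) * ‖v‖ ^ 2 := by
    have hL' : (0 : ℝ) < L := hL0
    field_simp
  have h11 := mul_le_mul_of_nonneg_left h1 hs.le
  have h12 := mul_le_mul_of_nonneg_left h2 ha.le
  rw [h4]
  linarith

end Smooth


/-! ### Convex analysis: local boundedness, sum rule, Fenchel–Young. -/

section Convex

variable {H : Type*} [NormedAddCommGroup H] [InnerProductSpace ℝ H]

theorem ConvexFun.le_real {f : H → EReal} (hf : ConvexFun f) {x y : H} {r s : ℝ} (hx : f x ≤ r)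
    (hy : f y ≤ s) {a b : ℝ} (ha : 0 ≤ a) (hb : 0 ≤ b) (hab : a + b = 1) :
    f (a • x + b • y) ≤ ((a * r + b * s : ℝ) : EReal) := by
  rcases ha.eq_or_lt with rfl | ha'
  · obtain rfl : b = 1 := by linarith
    simpa using hy
  rcases hb.eq_or_lt with rfl | hb'
  · obtain rfl : a = 1 := by linarith
    simpa using hx
  refine (hf x y a b ha' hb' hab).trans ?_
  rw [EReal.coe_add, EReal.coe_mul, EReal.coe_mul]
  exact add_le_add (mul_le_mul_of_nonneg_left hx (EReal.coe_nonneg.2 ha))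
    (mul_le_mul_of_nonneg_left hy (EReal.coe_nonneg.2 hb))

theorem ConvexFun.convex_epigraph {f : H → EReal} (hf : ConvexFun f) :
    Convex ℝ {p : H × ℝ | f p.1 ≤ p.2} :=
  fun _ hp _ hq _ _ ha hb hab => hf.le_real hp hq ha hb hab

theorem ConvexFun.convex_sublevel {f : H → EReal} (hf : ConvexFun f) (c : ℝ) :
    Convex ℝ {x : H | f x ≤ c} := by
  intro x hx y hy a b ha hb hab
  have := hf.le_real hx hy ha hb hab
  rwa [← add_mul, hab, one_mul] at this

theorem ConvexFun.coe {h : H → ℝ} (hh : ConvexOn ℝ Set.univ h) :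
    ConvexFun fun x => (h x : EReal) := by
  intro x y a b ha hb hab
  have := hh.2 (Set.mem_univ x) (Set.mem_univ y) ha.le hb.le hab
  simp only [smul_eq_mul] at this
  beta_reduce
  exact_mod_cast this

/-- A lower semicontinuous convex function on a Hilbert space is locally bounded above on the
interior of its domain. -/
theorem exists_eventually_le_of_mem_interior [CompleteSpace H] {f : H → EReal} (hf : ConvexFun f)
    (hlsc : LowerSemicontinuous f) {U : Set H} (hU : ∀ y ∈ U, f y ≠ ⊤) {x₀ : H}
    (hx₀ : x₀ ∈ interior U) : ∃ M : ℝ, ∀ᶠ y in 𝓝 x₀, f y ≤ M := by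
  have hreal : ∀ y ∈ U, ∃ n : ℕ, f y ≤ ((n : ℝ) : EReal) := by
    intro y hy
    obtain ⟨r, hr, -⟩ := EReal.lt_iff_exists_real_btwn.1 (lt_top_iff_ne_top.2 (hU y hy))
    obtain ⟨n, hn⟩ := exists_nat_ge r
    exact ⟨n, hr.le.trans (EReal.coe_le_coe_iff.2 hn)⟩
  -- Baire: the closed sublevel sets, enlarged by the complement of `interior U`, cover `H`, so `f`
  -- is bounded above near some `y₀` in `interior U`.
  have hdense := dense_iUnion_interior_of_closed
    (f := fun n : ℕ => {y | f y ≤ ((n : ℝ) : EReal)} ∪ (interior U)ᶜ)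
    (fun n => (hlsc.isClosed_preimage _).union isOpen_interior.isClosed_compl) (by
      refine Set.eq_univ_of_forall fun y => Set.mem_iUnion.2 ?_
      by_cases hy : y ∈ interior U
      · obtain ⟨n, hn⟩ := hreal y (interior_subset hy)
        exact ⟨n, Or.inl hn⟩
      · exact ⟨0, Or.inr hy⟩)
  obtain ⟨y₀, hy₀U, hy₀⟩ := hdense.inter_open_nonempty _ isOpen_interior ⟨x₀, hx₀⟩
  obtain ⟨n, hn⟩ := Set.mem_iUnion.1 hy₀
  have hn' : ∀ᶠ y in 𝓝 y₀, f y ≤ ((n : ℝ) : EReal) := by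
    filter_upwards [mem_interior_iff_mem_nhds.1 hn, isOpen_interior.mem_nhds hy₀U] with y h1 h2
    exact h1.resolve_right fun h3 => h3 h2
  -- Write `x₀ = (1 - b) • w + b • y₀` with `w ∈ U` slightly beyond `x₀`; convexity carries the
  -- bound near `y₀` to a neighbourhood of `x₀`.
  have hcont : ContinuousAt (fun b : ℝ => (1 - b)⁻¹ • (x₀ - b • y₀)) 0 := by
    refine ContinuousAt.smul (ContinuousAt.inv₀ (by fun_prop) (by norm_num)) (by fun_prop)
  have hev : ∀ᶠ b : ℝ in 𝓝[>] 0, (1 - b)⁻¹ • (x₀ - b • y₀) ∈ U := by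
    refine nhdsWithin_le_nhds (hcont.eventually ?_)
    simpa using mem_interior_iff_mem_nhds.1 hx₀
  obtain ⟨b, ⟨hb, hb0⟩, hb1⟩ := ((hev.and self_mem_nhdsWithin).and
    (nhdsWithin_le_nhds (eventually_lt_nhds (zero_lt_one' ℝ)))).exists
  have hb0 : 0 < b := hb0
  set w := (1 - b)⁻¹ • (x₀ - b • y₀) with hw
  obtain ⟨N, hN⟩ := hreal w hb
  have h1b : (1 - b) ≠ 0 := by linarith
  have hw' : (1 - b) • w = x₀ - b • y₀ := by rw [hw, smul_inv_smul₀ h1b]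
  refine ⟨(1 - b) * N + b * n, ?_⟩
  have hc2 : ContinuousAt (fun y => b⁻¹ • (y - (1 - b) • w)) x₀ := by fun_prop
  have he : b⁻¹ • (x₀ - (1 - b) • w) = y₀ := by
    rw [hw', sub_sub_cancel, inv_smul_smul₀ hb0.ne']
  filter_upwards [hc2.eventually (he.symm ▸ hn')] with y hy
  have := hf.le_real hN hy (by linarith : 0 ≤ 1 - b) hb0.le (by ring)
  rwa [smul_inv_smul₀ hb0.ne', add_sub_cancel] at this

/-- Fermat's rule for a sum of convex functions over a convex set, under the Moreau–Rockafellar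
qualification condition. -/
theorem exists_subgradients_of_isMin [CompleteSpace H] {ι : Type*} [Fintype ι]
    {F : ι → H → EReal} (hF : ∀ i, ConvexFun (F i)) {C : Set H} (hC : Convex ℝ C) {x₀ : H}
    (hx₀ : x₀ ∈ C) (hb : ∀ i, ∃ M : ℝ, ∀ᶠ y in 𝓝 x₀, F i y ≤ M) {u : H} (hu : u ∈ C) {w : ι → ℝ}
    (hw : ∀ i, F i u = w i)
    (hmin : ∀ c ∈ C, ∀ r : ι → ℝ, (∀ i, F i c ≤ r i) → ∑ i, w i ≤ ∑ i, r i) :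
    ∃ v : ι → H, (∀ i y (r : ℝ), F i y ≤ r → w i + inner ℝ (v i) (y - u) ≤ r) ∧
      ∀ c ∈ C, 0 ≤ ∑ i, inner ℝ (v i) (c - u) := by
  classical
  choose M hM using hb
  -- `A` is the strict epigraph of `(y i) ↦ ∑ F i (y i)` on the product space, `B` the diagonal copy
  -- of `C` at the minimal height. One separation in the product yields all subgradients
  -- simultaneously.
  set A : Set ((ι → H) × ℝ) := {p | ∃ r : ι → ℝ, (∀ i, F i (p.1 i) ≤ r i) ∧ ∑ i, r i < p.2} with hA
  set B : Set ((ι → H) × ℝ) := (fun c : H => ((fun _ => c : ι → H), ∑ i, w i)) '' C with hB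
  have hAconv : Convex ℝ A := by
    rintro p ⟨r, hr, hrt⟩ q ⟨s, hs, hst⟩ a b ha hb hab
    refine ⟨fun i => a * r i + b * s i, fun i => (hF i).le_real (hr i) (hs i) ha hb hab, ?_⟩
    rw [Finset.sum_add_distrib, ← Finset.mul_sum, ← Finset.mul_sum]
    change _ < a * p.2 + b * q.2
    rcases ha.eq_or_lt with rfl | ha'
    · obtain rfl : b = 1 := by linarith
      linarith
    · nlinarith
  have hBconv : Convex ℝ B := by
    rintro _ ⟨c, hc, rfl⟩ _ ⟨d, hd, rfl⟩ a b ha hb hab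
    refine ⟨a • c + b • d, hC hc hd ha hb hab, ?_⟩
    ext
    · simp
    · change _ = a * _ + b * _
      rw [← add_mul, hab, one_mul]
  have hdisj : Disjoint (interior A) B := by
    rw [Set.disjoint_left]
    rintro _ hp ⟨c, hc, rfl⟩
    obtain ⟨r, hr, hrt⟩ := interior_subset hp
    exact absurd (hmin c hc r hr) (not_le.2 hrt)
  have hint : ∀ t, ∑ i, M i < t → ((fun _ => x₀ : ι → H), t) ∈ interior A := by
    intro t ht
    rw [mem_interior_iff_mem_nhds]
    have h1 : ∀ᶠ p : (ι → H) × ℝ in 𝓝 ((fun _ => x₀ : ι → H), t), ∀ i, F i (p.1 i) ≤ M i :=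
      eventually_all.2 fun i =>
        (show ContinuousAt (fun p : (ι → H) × ℝ => p.1 i) ((fun _ => x₀ : ι → H), t) by
          fun_prop).eventually (hM i)
    have h2 : ∀ᶠ p : (ι → H) × ℝ in 𝓝 ((fun _ => x₀ : ι → H), t), ∑ i, M i < p.2 :=
      continuousAt_snd.eventually (lt_mem_nhds ht)
    filter_upwards [h1, h2] with p hp1 hp2 using ⟨M, hp1, hp2⟩
  obtain ⟨φ, s, hφA, hφB⟩ := geometric_hahn_banach_open hAconv.interior isOpen_interior hBconv hdisj
  have hne : (interior A).Nonempty := ⟨_, hint (∑ i, M i + 1) (by linarith)⟩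
  have hφA' : ∀ p ∈ A, φ p ≤ s := fun p hp => by
    have : closure (interior A) ⊆ {p | φ p ≤ s} :=
      closure_minimal (fun x hx => (hφA x hx).le) (isClosed_Iic.preimage φ.continuous)
    rw [hAconv.closure_interior_eq_closure_of_nonempty_interior hne] at this
    exact this (subset_closure hp)
  set ℓ : ι → H →L[ℝ] ℝ := fun i =>
    φ.comp ((ContinuousLinearMap.inl ℝ (ι → H) ℝ).comp
      (ContinuousLinearMap.single ℝ (fun _ : ι => H) i)) with hℓ
  set lam : ℝ := φ (0, 1) with hlam
  have hφ : ∀ (y : ι → H) (t : ℝ), φ (y, t) = ∑ i, ℓ i (y i) + lam * t := by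
    intro y t
    have h1 : (y, t) = (∑ i, ((Pi.single i (y i) : ι → H), (0 : ℝ))) + t • ((0 : ι → H), (1 : ℝ)) := by
      ext1
      · simp [Prod.fst_sum, Finset.univ_sum_single]
      · simp [Prod.snd_sum]
    rw [h1, map_add, map_sum, map_smul, smul_eq_mul, mul_comm t]
    rfl
  -- The hyperplane is not vertical: over the diagonal point of `x₀`, `interior A` contains a point
  -- strictly above the point of `B`.
  have hlam0 : lam < 0 := by
    have h1 := hφA _ (hint (max (∑ i, M i) (∑ i, w i) + 1)
      (lt_of_le_of_lt (le_max_left _ (∑ i, w i)) (lt_add_one _)))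
    have h2 := hφB _ ⟨x₀, hx₀, rfl⟩
    rw [hφ] at h1 h2
    have h3 := le_max_right (∑ i, M i) (∑ i, w i)
    by_contra hneg
    push Not at hneg
    nlinarith
  have main : ∀ (y : ι → H) (r : ι → ℝ), (∀ i, F i (y i) ≤ r i) → ∀ c ∈ C,
      ∑ i, ℓ i (y i) + lam * ∑ i, r i ≤ ∑ i, ℓ i c + lam * ∑ i, w i := by
    intro y r hr c hc
    have h2 := hφB _ ⟨c, hc, rfl⟩
    rw [hφ] at h2
    refine le_trans ?_ h2
    refine le_of_forall_pos_le_add fun ε hε => ?_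
    have h1 := hφA' (y, ∑ i, r i + ε / -lam) ⟨r, hr, by
      have := div_pos hε (neg_pos.2 hlam0)
      simpa using this⟩
    rw [hφ] at h1
    have h3 : lam * (∑ i, r i + ε / -lam) = lam * ∑ i, r i - ε := by
      have := hlam0.ne
      field_simp
      ring
    linarith
  have hv : ∀ i z, inner ℝ ((InnerProductSpace.toDual ℝ H).symm ((-lam)⁻¹ • ℓ i)) z
      = (-lam)⁻¹ * ℓ i z := fun i z => by
    rw [InnerProductSpace.toDual_symm_apply]; rfl
  have hpos : 0 < (-lam)⁻¹ := inv_pos.2 (neg_pos.2 hlam0)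
  have hone : (-lam)⁻¹ * lam = -1 := by
    have := hlam0.ne
    field_simp
  refine ⟨fun i => (InnerProductSpace.toDual ℝ H).symm ((-lam)⁻¹ • ℓ i), ?_, ?_⟩
  · intro i y r hy
    -- Moving only the `i`-th coordinate away from `u` isolates the subgradient inequality of `F i`.
    have h1 := main (Function.update (fun _ => u) i y) (Function.update w i r) (fun j => by
      rcases eq_or_ne j i with rfl | hj
      · simpa using hy
      · simp [hj, hw]) u hu
    have h2 : ∑ j, ℓ j ((Function.update (fun _ => u) i y : ι → H) j)
        = ∑ j, ℓ j u + (ℓ i y - ℓ i u) := by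
      rw [← Finset.add_sum_erase _ _ (Finset.mem_univ i),
        ← Finset.add_sum_erase _ (fun j => ℓ j u) (Finset.mem_univ i)]
      rw [Finset.sum_congr rfl (fun j hj => by
        rw [Function.update_of_ne (Finset.ne_of_mem_erase hj)] :
        ∀ j ∈ Finset.univ.erase i, ℓ j ((Function.update (fun _ => u) i y : ι → H) j) = ℓ j u)]
      simp only [Function.update_self]
      ring
    have h3 : ∑ j, Function.update w i r j = ∑ j, w j + (r - w i) := by
      rw [← Finset.add_sum_erase _ _ (Finset.mem_univ i),
        ← Finset.add_sum_erase _ w (Finset.mem_univ i)]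
      rw [Finset.sum_congr rfl (fun j hj => by
        rw [Function.update_of_ne (Finset.ne_of_mem_erase hj)] :
        ∀ j ∈ Finset.univ.erase i, Function.update w i r j = w j)]
      simp only [Function.update_self]
      ring
    rw [h2, h3] at h1
    rw [hv, map_sub]
    have h4 : (ℓ i y - ℓ i u) + lam * (r - w i) ≤ 0 := by nlinarith
    have h5 := mul_nonpos_of_nonneg_of_nonpos hpos.le h4
    have h6 : (-lam)⁻¹ * (lam * (r - w i)) = -(r - w i) := by rw [← mul_assoc, hone]; ring
    nlinarith
  · intro c hc
    have h1 := main (fun _ => u) w (fun i => (hw i).le) c hc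
    simp only [hv, map_sub]
    rw [← Finset.mul_sum, Finset.sum_sub_distrib]
    exact mul_nonneg hpos.le (by linarith)

theorem convex_argmin {g : H → ℝ} (hg : ConvexOn ℝ Set.univ g) : Convex ℝ (argmin g) := by
  intro x hx y hy a b ha hb hab z
  have h1 := hg.2 (Set.mem_univ x) (Set.mem_univ y) ha hb hab
  have h2 := mul_le_mul_of_nonneg_left (hx z) ha
  have h3 := mul_le_mul_of_nonneg_left (hy z) hb
  have h4 : a * g z + b * g z = g z := by rw [← add_mul, hab, one_mul]
  simp only [smul_eq_mul] at h1
  linarith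

/-- Fenchel–Young bounds the conjugate below at `y`; normality of `p` at `u` bounds the support
function above by `⟨p / b, u⟩`. -/
theorem penaltyTerm_ge {g : H → ℝ} {a b : ℝ} (ha : 0 < a) (hb : 0 < b) {p u : H}
    (hp : p ∈ normalCone (argmin g) u) (y : H) :
    ENNReal.ofReal (a * inner ℝ p (y - u) - a * b * g y) ≤ penaltyTerm g a b p := by
  rw [penaltyTerm, ← EReal.real_coe_toENNReal]
  refine EReal.toENNReal_le_toENNReal ?_
  have h1 : supportFun (argmin g) (b⁻¹ • p) ≤ ((inner ℝ (b⁻¹ • p) u : ℝ) : EReal) := by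
    refine iSup₂_le fun z hz => EReal.coe_le_coe_iff.2 ?_
    have h2 := hp.2 z hz
    rw [inner_sub_right] at h2
    rw [real_inner_smul_left, real_inner_smul_left]
    exact mul_le_mul_of_nonneg_left (by linarith) (inv_nonneg.2 hb.le)
  have h2 : ((inner ℝ (b⁻¹ • p) y - g y : ℝ) : EReal)
      ≤ conj (fun u => ((g u : ℝ) : EReal)) (b⁻¹ • p) :=
    le_iSup (fun u : H => ((inner ℝ (b⁻¹ • p) u : ℝ) : EReal) - ((g u : ℝ) : EReal)) y
  have h3 := mul_le_mul_of_nonneg_left (EReal.sub_le_sub h2 h1)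
    (EReal.coe_nonneg.2 (mul_pos ha hb).le)
  refine le_trans (le_of_eq ?_) h3
  rw [← EReal.coe_sub, ← EReal.coe_mul, EReal.coe_eq_coe_iff, real_inner_smul_left,
    real_inner_smul_left, inner_sub_right]
  field_simp
  ring

end Convex


/-! ### Estimates for one iteration. -/

section Step

variable {H : Type*} [NormedAddCommGroup H] [InnerProductSpace ℝ H]

/-- Subgradient inequalities hold at the inner iterates; this transfers them to the outer iterate
`x`. -/
theorem norm_sub_le_of_chain {m : ℕ} (ψ : ℕ → H) (x y v : H) {a s : ℝ} (ha : 0 ≤ a) (hs : 0 ≤ s)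
    (h0 : ψ 0 = x - a • y - s • v) {j : ℕ} (hj : j ≤ m) :
    ‖ψ j - x‖ ≤ ∑ i : Fin m, ‖ψ (i + 1) - ψ i‖ + (a * ‖y‖ + s * ‖v‖) := by
  have h1 : ‖ψ j - ψ 0‖ ≤ ∑ i ∈ Finset.range j, ‖ψ (i + 1) - ψ i‖ := by
    rw [← Finset.sum_range_sub]
    exact norm_sum_le _ _
  have h2 : ∑ i ∈ Finset.range j, ‖ψ (i + 1) - ψ i‖ ≤ ∑ i ∈ Finset.range m, ‖ψ (i + 1) - ψ i‖ :=
    Finset.sum_le_sum_of_subset_of_nonneg (Finset.range_mono hj) fun _ _ _ => norm_nonneg _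
  have h3 : ‖ψ 0 - x‖ ≤ a * ‖y‖ + s * ‖v‖ := by
    have : ψ 0 - x = -(a • y + s • v) := by rw [h0]; abel
    rw [this, norm_neg]
    refine (norm_add_le _ _).trans ?_
    rw [norm_smul, norm_smul, Real.norm_of_nonneg ha, Real.norm_of_nonneg hs]
  have h4 := norm_add_le (ψ j - ψ 0) (ψ 0 - x)
  rw [sub_add_sub_cancel] at h4
  rw [Fin.sum_univ_eq_sum_range (fun i => ‖ψ (i + 1) - ψ i‖)]
  linarith

variable [CompleteSpace H]

theorem sq_norm_gradient_le_of_lipschitz {h : H → ℝ} {L : ℝ≥0} (hL : LipschitzWith L (gradient h))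
    (x u : H) : ‖gradient h x‖ ^ 2 ≤ 2 * ‖gradient h u‖ ^ 2 + 2 * (L : ℝ) ^ 2 * ‖x - u‖ ^ 2 := by
  have h1 := hL.norm_sub_le x u
  have h2 := norm_add_le (gradient h x - gradient h u) (gradient h u)
  rw [sub_add_cancel] at h2
  have h3 : ‖gradient h x‖ ^ 2 ≤ (L * ‖x - u‖ + ‖gradient h u‖) ^ 2 := by
    gcongr; linarith
  nlinarith [sq_nonneg (L * ‖x - u‖ - ‖gradient h u‖)]

/-- The effect of one full iteration on the distance to a minimizer of the penalty. -/
theorem iteration_norm_sq_le {m : ℕ} {f : Fin m → H → EReal} {h g : H → ℝ}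
    (hf : ∀ i, ConvexFun (f i)) (hh : ConvexOn ℝ Set.univ h)
    (hhd : Differentiable ℝ h) (hc : ConvexOn ℝ Set.univ g) (hg : Differentiable ℝ g) {L : ℝ≥0}
    (hL0 : 0 < L) (hL : LipschitzWith L (gradient g)) {u : H} (hu : u ∈ argmin g)
    (hgu : g u = 0) {a s q ε : ℝ} (ha : 0 < a) (hs : 0 < s) (hsq : s ≤ q) (hε : 0 < ε) {x : H}
    {ψ : ℕ → H} (h0 : ψ 0 = x - a • gradient h x - s • gradient g x)
    (hψ : ∀ i : Fin m, IsProx a (f i) (ψ i) (ψ (i + 1)))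
    {φ w : Fin m → ℝ} (hφ : ∀ i : Fin m, f i (ψ (i + 1)) = φ i) (hw : ∀ i, f i u = w i) :
    ‖ψ m - u‖ ^ 2 + ∑ i : Fin m, ‖ψ (i + 1) - ψ i‖ ^ 2
        + 2 * s * g x + s * (1 / L - (1 + ε) * q) * ‖gradient g x‖ ^ 2
      ≤ ‖x - u‖ ^ 2 + (1 + 1 / ε) * a ^ 2 * ‖gradient h x‖ ^ 2
        + 2 * a * (∑ i, (w i - φ i) + (h u - h x)) := by
  have h1 := prox_chain_norm_sq_le hf ha hψ hφ hw
  have h2 := gradient_step_norm_sq_le hh hhd hc hg hL0 hL hu hgu ha hs hsq hε x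
  rw [← h0] at h2
  linarith

/-- Subgradients at `u` replace the function values by `⟨p, x - u⟩` plus an error `V * D` measuring
how far the inner iterates are from `x`. One of the two copies of `s * g x` goes into `θ`, the other
stays on the left. -/
theorem fejer_step {m : ℕ} {f : Fin m → H → EReal} {h g : H → ℝ}
    (hf : ∀ i, ConvexFun (f i)) (hh : ConvexOn ℝ Set.univ h)
    (hhd : Differentiable ℝ h) (hc : ConvexOn ℝ Set.univ g) (hg : Differentiable ℝ g) {L Lh : ℝ≥0}
    (hL0 : 0 < L) (hL : LipschitzWith L (gradient g)) (hLh : LipschitzWith Lh (gradient h))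
    {u : H} (hu : u ∈ argmin g)
    (hgu : g u = 0) {a s q ε κ θ : ℝ} (ha : 0 < a) (hs : 0 < s) (hsq : s ≤ q) (hε : 0 < ε)
    (hκ : 0 < κ) (hκs : κ ≤ s * (1 / L - (1 + ε) * q)) {x : H}
    {ψ : ℕ → H} (h0 : ψ 0 = x - a • gradient h x - s • gradient g x)
    (hψ : ∀ i : Fin m, IsProx a (f i) (ψ i) (ψ (i + 1)))
    {φ w : Fin m → ℝ} (hφ : ∀ i : Fin m, f i (ψ (i + 1)) = φ i) (hw : ∀ i, f i u = w i)
    {v : Fin m → H} {v₀ : H} (hv : ∀ i y (r : ℝ), f i y ≤ r → w i + inner ℝ (v i) (y - u) ≤ r)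
    (hv₀ : ∀ y, h u + inner ℝ v₀ (y - u) ≤ h y)
    (hθ : 2 * a * inner ℝ (-(∑ i, v i + v₀)) (x - u) - s * g x ≤ θ) :
    ‖ψ m - u‖ ^ 2 + ((∑ i : Fin m, ‖ψ (i + 1) - ψ i‖ ^ 2) / 2
        + s * g x + κ / 2 * ‖gradient g x‖ ^ 2)
      ≤ (1 + 2 * (2 + 1 / ε) * (Lh : ℝ) ^ 2 * a ^ 2) * ‖x - u‖ ^ 2 +
        ((2 * (2 + 1 / ε) * ‖gradient h u‖ ^ 2
          + (∑ i, ‖v i‖) ^ 2 * (2 * m + 1 + 2 * q ^ 2 / κ)) * a ^ 2 + θ) := by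
  have h1 := iteration_norm_sq_le hf hh hhd hc hg hL0 hL hu hgu ha hs hsq hε h0 hψ hφ hw
  have hY := sq_norm_gradient_le_of_lipschitz hLh x u
  set y := gradient h x
  set z := gradient g x
  set d : Fin m → ℝ := fun i => ‖ψ (i + 1) - ψ i‖ with hd
  set V := ∑ i, ‖v i‖ with hV
  have hV0 : 0 ≤ V := Finset.sum_nonneg fun i _ => norm_nonneg _
  set D := ∑ i, d i + (a * ‖y‖ + s * ‖z‖) with hD
  have h2 : ∑ i, (w i - φ i) + (h u - h x)
      ≤ inner ℝ (-(∑ i, v i + v₀)) (x - u) + V * D := by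
    have h3 : ∀ i : Fin m, w i - φ i ≤ -inner ℝ (v i) (x - u) + ‖v i‖ * D := by
      intro i
      have h4 := hv i (ψ (i + 1)) (φ i) (hφ i).le
      have h5 : ψ (i + 1) - u = (ψ (i + 1) - x) + (x - u) := by abel
      rw [h5, inner_add_right] at h4
      have h6 := neg_le_of_abs_le (abs_real_inner_le_norm (v i) (ψ (i + 1) - x))
      have h7 := mul_le_mul_of_nonneg_left
        (norm_sub_le_of_chain ψ x y z ha.le hs.le h0 i.2) (norm_nonneg (v i))
      linarith
    have h4 := Finset.sum_le_sum fun i (_ : i ∈ Finset.univ) => h3 i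
    rw [Finset.sum_add_distrib, ← Finset.sum_mul, Finset.sum_neg_distrib] at h4
    rw [inner_neg_left, inner_add_left, sum_inner]
    linarith [hv₀ x]
  have h3 := mul_le_mul_of_nonneg_left h2 (by positivity : 0 ≤ 2 * a)
  -- The three parts of `2 * a * V * D` are split by Young's inequality: half of the squared steps
  -- and half of `κ * ‖z‖ ^ 2` are spent, and the rest carries a factor `a ^ 2`.
  have h4 : 2 * a * V * ∑ i, d i ≤ (∑ i, d i ^ 2) / 2 + 2 * m * a ^ 2 * V ^ 2 := by
    have : ∀ i, 2 * a * V * d i ≤ d i ^ 2 / 2 + 2 * a ^ 2 * V ^ 2 := fun i => by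
      nlinarith [sq_nonneg (d i - 2 * a * V)]
    have h5 := Finset.sum_le_sum fun i (_ : i ∈ Finset.univ) => this i
    rw [← Finset.mul_sum, Finset.sum_add_distrib, ← Finset.sum_div, Finset.sum_const,
      Finset.card_univ, Fintype.card_fin, nsmul_eq_mul] at h5
    linarith
  have h5 : 2 * a * V * (a * ‖y‖) ≤ a ^ 2 * V ^ 2 + a ^ 2 * ‖y‖ ^ 2 := by
    nlinarith [sq_nonneg (a * V - a * ‖y‖)]
  have h6 : 2 * a * V * (s * ‖z‖) ≤ κ / 2 * ‖z‖ ^ 2 + 2 * q ^ 2 / κ * (a ^ 2 * V ^ 2) := by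
    have e : 0 ≤ κ / 2 * (‖z‖ - 2 * (q * (a * V)) / κ) ^ 2 := by positivity
    have e2 : κ / 2 * (‖z‖ - 2 * (q * (a * V)) / κ) ^ 2 = κ / 2 * ‖z‖ ^ 2
      - 2 * a * V * (q * ‖z‖) + 2 * q ^ 2 / κ * (a ^ 2 * V ^ 2) := by
      field_simp
      ring
    have e3 : 2 * a * V * (s * ‖z‖) ≤ 2 * a * V * (q * ‖z‖) := by gcongr
    linarith
  have h7 : κ * ‖z‖ ^ 2 ≤ s * (1 / L - (1 + ε) * q) * ‖z‖ ^ 2 :=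
    mul_le_mul_of_nonneg_right hκs (sq_nonneg _)
  have h8 : (2 + 1 / ε) * a ^ 2 * ‖y‖ ^ 2 ≤ (2 + 1 / ε) * a ^ 2 *
      (2 * ‖gradient h u‖ ^ 2 + 2 * (Lh : ℝ) ^ 2 * ‖x - u‖ ^ 2) :=
    mul_le_mul_of_nonneg_left hY (by positivity)
  rw [hD] at h3
  linarith

end Step

/-! ### Summing the estimates along the iteration. -/

section Run

variable {H : Type*} [NormedAddCommGroup H] [InnerProductSpace ℝ H] [CompleteSpace H]

/-- The iterates of the algorithm, indexed from `0`. -/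
structure IsRun {m : ℕ} (f : Fin m → H → EReal) (h g : H → ℝ) (a b : ℕ → ℝ) (X : ℕ → H)
    (Ψ : ℕ → ℕ → H) : Prop where
  a_pos : ∀ n, 0 < a n
  b_pos : ∀ n, 0 < b n
  start : ∀ n, Ψ n 0 = X n - a n • gradient h (X n) - (a n * b n) • gradient g (X n)
  step : ∀ n, ∀ i : Fin m, IsProx (a n) (f i) (Ψ n i) (Ψ n (i + 1))
  next : ∀ n, X (n + 1) = Ψ n m

theorem IsGenerated.isRun {m : ℕ} {f : Fin m → H → EReal} {h g : H → ℝ} {α β : ℕ → ℝ} {x : ℕ → H}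
    {ψ : ℕ → ℕ → H} (hx : IsGenerated f h g α β x ψ) (hα : ∀ k, 1 ≤ k → 0 < α k)
    (hβ : ∀ k, 1 ≤ k → 0 < β k) :
    IsRun f h g (fun n => α (n + 1)) (fun n => β (n + 1)) (fun n => x (n + 1))
      (fun n => ψ (n + 1)) where
  a_pos n := hα _ (by omega)
  b_pos n := hβ _ (by omega)
  start n := hx.start _ (by omega)
  step n i := hx.step _ (by omega) i
  next n := hx.next _ (by omega)

/-- The bounds on `a n * b n` hold only eventually; dropping finitely many iterations makes them
uniform. -/
theorem IsRun.shift {m : ℕ} {f : Fin m → H → EReal} {h g : H → ℝ} {a b : ℕ → ℝ} {X : ℕ → H}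
    {Ψ : ℕ → ℕ → H} (hX : IsRun f h g a b X Ψ) (N : ℕ) :
    IsRun f h g (fun n => a (n + N)) (fun n => b (n + N)) (fun n => X (n + N))
      (fun n => Ψ (n + N)) where
  a_pos n := hX.a_pos _
  b_pos n := hX.b_pos _
  start n := hX.start _
  step n i := hX.step _ i
  next n := by rw [← hX.next, add_right_comm]

theorem IsRun.fejer {m : ℕ} {f : Fin m → H → EReal} {h g : H → ℝ} {a b : ℕ → ℝ} {X : ℕ → H}
    {Ψ : ℕ → ℕ → H} (hX : IsRun f h g a b X Ψ) (hfp : ∀ i, Proper (f i))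
    (hf : ∀ i, ConvexFun (f i)) (hh : ConvexOn ℝ Set.univ h)
    (hhd : Differentiable ℝ h) (hc : ConvexOn ℝ Set.univ g) (hg : Differentiable ℝ g) {L Lh : ℝ≥0}
    (hL0 : 0 < L) (hL : LipschitzWith L (gradient g)) (hLh : LipschitzWith Lh (gradient h))
    {u : H} (hu : u ∈ argmin g) (hgu : g u = 0) {l q : ℝ} (hl : 0 < l)
    (hlab : ∀ n, l ≤ a n * b n) (habq : ∀ n, a n * b n ≤ q) (hq : q < 1 / L)
    (ha2 : Summable fun n => a n ^ 2) {w : Fin m → ℝ} (hw : ∀ i, f i u = w i)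
    {v : Fin m → H} {v₀ : H} (hv : ∀ i y (r : ℝ), f i y ≤ r → w i + inner ℝ (v i) (y - u) ≤ r)
    (hv₀ : ∀ y, h u + inner ℝ v₀ (y - u) ≤ h y) {θ : ℕ → ℝ} (hθ0 : ∀ n, 0 ≤ θ n)
    (hθs : Summable θ)
    (hθ : ∀ n, 2 * a n * inner ℝ (-(∑ i, v i + v₀)) (X n - u) - a n * b n * g (X n) ≤ θ n) :
    (∃ r, Tendsto (fun n => ‖X n - u‖ ^ 2) atTop (𝓝 r)) ∧ Tendsto (fun n => g (X n)) atTop (𝓝 0) ∧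
      ∀ j ≤ m, Tendsto (fun n => Ψ n j - X n) atTop (𝓝 0) := by
  have hL' : (0 : ℝ) < L := hL0
  have hq0 : 0 < q := hl.trans_le ((hlab 0).trans (habq 0))
  obtain ⟨ε, hε, hεq⟩ : ∃ ε : ℝ, 0 < ε ∧ 0 < 1 / (L : ℝ) - (1 + ε) * q := by
    -- This choice puts `(1 + ε) * q` halfway between `q` and `1 / L`, leaving a positive
    -- coefficient on the squared gradient.
    refine ⟨(1 / L - q) / (2 * q), div_pos (by linarith) (by linarith), ?_⟩
    have : (1 + (1 / (L : ℝ) - q) / (2 * q)) * q = q + (1 / L - q) / 2 := by field_simp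
    rw [this]
    linarith
  set κ := l * (1 / (L : ℝ) - (1 + ε) * q) with hκ
  have hκ0 : 0 < κ := mul_pos hl hεq
  have hg0 : ∀ x, 0 ≤ g x := fun x => hgu ▸ hu x
  have hs : ∀ n, 0 < a n * b n := fun n => mul_pos (hX.a_pos n) (hX.b_pos n)
  choose φ hφ using fun n (i : Fin m) => (hX.step n i).exists_real (hfp i)
  have key := fun n => fejer_step hf hh hhd hc hg hL0 hL hLh hu hgu (hX.a_pos n) (hs n) (habq n) hε
    hκ0 (mul_le_mul_of_nonneg_right (hlab n) hεq.le) (hX.start n) (hX.step n) (hφ n) hw hv hv₀ (hθ n)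
  simp only [← hX.next] at key
  have hd0 : ∀ n, 0 ≤ ∑ i : Fin m, ‖Ψ n (i + 1) - Ψ n i‖ ^ 2 :=
    fun n => Finset.sum_nonneg fun i _ => sq_nonneg _
  have hsg0 : ∀ n, 0 ≤ a n * b n * g (X n) := fun n => mul_nonneg (hs n).le (hg0 _)
  have hz0 : ∀ n, 0 ≤ κ / 2 * ‖gradient g (X n)‖ ^ 2 := fun n => by positivity
  obtain ⟨hconv, hsum⟩ := tendsto_and_summable_of_le_mul_add (fun n => sq_nonneg ‖X n - u‖)
    (fun n => add_nonneg (add_nonneg (div_nonneg (hd0 n) zero_le_two) (hsg0 n)) (hz0 n))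
    (fun n => by positivity) (ha2.mul_left _)
    (fun n => add_nonneg (by positivity) (hθ0 n)) ((ha2.mul_left _).add hθs) key
  have hlim := hsum.tendsto_atTop_zero
  have hglim : Tendsto (fun n => g (X n)) atTop (𝓝 0) := by
    refine squeeze_zero (fun n => hg0 _) (fun n => ?_) (by simpa using hlim.div_const l)
    rw [le_div_iff₀ hl]
    nlinarith [hd0 n, hz0 n, mul_le_mul_of_nonneg_right (hlab n) (hg0 (X n))]
  have hdlim : ∀ i : Fin m, Tendsto (fun n => ‖Ψ n (i + 1) - Ψ n i‖) atTop (𝓝 0) := by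
    intro i
    have : Tendsto (fun n => ‖Ψ n (i + 1) - Ψ n i‖ ^ 2) atTop (𝓝 0) := by
      refine squeeze_zero (fun n => sq_nonneg _) (fun n => ?_) (by simpa using hlim.const_mul 2)
      have := Finset.single_le_sum (f := fun i : Fin m => ‖Ψ n (i + 1) - Ψ n i‖ ^ 2)
        (fun i _ => sq_nonneg _) (Finset.mem_univ i)
      linarith [hsg0 n, hz0 n]
    simpa [Real.sqrt_sq] using this.sqrt
  have hzlim : Tendsto (fun n => ‖gradient g (X n)‖) atTop (𝓝 0) := by
    have : Tendsto (fun n => ‖gradient g (X n)‖ ^ 2) atTop (𝓝 0) := by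
      refine squeeze_zero (fun n => sq_nonneg _) (fun n => ?_)
        (by simpa using hlim.div_const (κ / 2))
      rw [le_div_iff₀ (by positivity)]
      linarith [hsg0 n, hd0 n]
    simpa [Real.sqrt_sq] using this.sqrt
  have halim : Tendsto a atTop (𝓝 0) := by
    have := ha2.tendsto_atTop_zero.sqrt
    simpa [Real.sqrt_sq (hX.a_pos _).le] using this
  refine ⟨hconv, hglim, fun j hj => ?_⟩
  obtain ⟨r, hr⟩ := hconv
  have hylim : Tendsto (fun n => a n * ‖gradient h (X n)‖) atTop (𝓝 0) := by
    have h1 : Tendsto (fun n => a n * (‖gradient h u‖ + Lh * √(‖X n - u‖ ^ 2))) atTop (𝓝 0) := by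
      simpa using halim.mul ((hr.sqrt.const_mul (Lh : ℝ)).const_add ‖gradient h u‖)
    refine squeeze_zero (fun n => mul_nonneg (hX.a_pos n).le (norm_nonneg _)) (fun n => ?_) h1
    refine mul_le_mul_of_nonneg_left ?_ (hX.a_pos n).le
    rw [Real.sqrt_sq (norm_nonneg _)]
    have h2 := hLh.norm_sub_le (X n) u
    have h3 := norm_add_le (gradient h (X n) - gradient h u) (gradient h u)
    rw [sub_add_cancel] at h3
    linarith
  have hslim : Tendsto (fun n => a n * b n * ‖gradient g (X n)‖) atTop (𝓝 0) :=
    squeeze_zero (fun n => mul_nonneg (hs n).le (norm_nonneg _))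
      (fun n => mul_le_mul_of_nonneg_right (habq n) (norm_nonneg _))
      (by simpa using hzlim.const_mul q)
  refine squeeze_zero_norm (fun n => norm_sub_le_of_chain (Ψ n) (X n) _ _ (hX.a_pos n).le (hs n).le
    (hX.start n) hj) ?_
  simpa using (tendsto_finsetSum Finset.univ fun i _ => hdlim i).add (hylim.add hslim)

/-- Telescoping; the finitely many exceptional indices are absorbed into the constant. -/
theorem exists_sum_range_le {A t r : ℕ → ℝ} (hA : ∀ n, 0 ≤ A n) (hr : ∀ n, 0 ≤ r n)
    (hrs : Summable r) (ht : ∀ᶠ n in atTop, t n ≤ A n - A (n + 1) + r n) :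
    ∃ K, ∀ N, ∑ n ∈ Finset.range N, t n ≤ K := by
  obtain ⟨n₀, hn₀⟩ := eventually_atTop.1 ht
  set e : ℕ → ℝ := fun n => t n - (A n - A (n + 1) + r n) with he
  refine ⟨A 0 + ∑' n, r n + ∑ n ∈ Finset.range n₀, |e n|, fun N => ?_⟩
  have h1 : ∑ n ∈ Finset.range N, t n = ∑ n ∈ Finset.range N, e n
      + (∑ n ∈ Finset.range N, (A n - A (n + 1)) + ∑ n ∈ Finset.range N, r n) := by
    rw [← Finset.sum_add_distrib, ← Finset.sum_add_distrib]
    exact Finset.sum_congr rfl fun n _ => by simp only [he]; ring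
  have h2 : ∑ n ∈ Finset.range N, e n ≤ ∑ n ∈ Finset.range n₀, |e n| := by
    calc ∑ n ∈ Finset.range N, e n
        ≤ ∑ n ∈ Finset.range N, if n < n₀ then |e n| else 0 := by
          refine Finset.sum_le_sum fun n _ => ?_
          split_ifs with hn
          · exact le_abs_self _
          · linarith [hn₀ n (not_lt.1 hn)]
      _ = ∑ n ∈ Finset.range N with n < n₀, |e n| := (Finset.sum_filter _ _).symm
      _ ≤ _ := Finset.sum_le_sum_of_subset_of_nonneg (fun n hn => by
          simp only [Finset.mem_filter] at hn
          exact Finset.mem_range.2 hn.2) fun _ _ _ => abs_nonneg _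
  rw [h1, Finset.sum_range_sub']
  linarith [hA N, hrs.sum_le_tsum (Finset.range N) fun n _ => hr n]

/-- No optimality of `u` is needed: once the iterates are bounded, the error from `h` is a constant
times `a n ^ 2`. -/
theorem IsRun.exists_sum_le {m : ℕ} {f : Fin m → H → EReal} {h g : H → ℝ} {a b : ℕ → ℝ}
    {X : ℕ → H} {Ψ : ℕ → ℕ → H} (hX : IsRun f h g a b X Ψ)
    (hf : ∀ i, ConvexFun (f i)) (hh : ConvexOn ℝ Set.univ h)
    (hhd : Differentiable ℝ h) (hc : ConvexOn ℝ Set.univ g) (hg : Differentiable ℝ g) {L Lh : ℝ≥0}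
    (hL0 : 0 < L) (hL : LipschitzWith L (gradient g)) (hLh : LipschitzWith Lh (gradient h))
    {u : H} (hu : u ∈ argmin g) (hgu : g u = 0) {q : ℝ}
    (habq : ∀ᶠ n in atTop, a n * b n ≤ q) (hq : q < 1 / L)
    (ha2 : Summable fun n => a n ^ 2) {R : ℝ} (hR : ∀ n, ‖X n - u‖ ≤ R)
    {w : Fin m → ℝ} (hw : ∀ i, f i u = w i)
    {φ : ℕ → Fin m → ℝ} (hφ : ∀ n (i : Fin m), f i (Ψ n (i + 1)) = φ n i) :
    ∃ K, ∀ N, ∑ n ∈ Finset.range N, a n * (∑ i, φ n i + h (X n)) ≤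
      K + (∑ n ∈ Finset.range N, a n) * (∑ i, w i + h u) := by
  have hL' : (0 : ℝ) < L := hL0
  have hs : ∀ n, 0 < a n * b n := fun n => mul_pos (hX.a_pos n) (hX.b_pos n)
  have hq0 : 0 < q := by
    obtain ⟨n, hn⟩ := habq.exists
    exact (hs n).trans_le hn
  obtain ⟨ε, hε, hεq⟩ : ∃ ε : ℝ, 0 < ε ∧ 0 ≤ 1 / (L : ℝ) - (1 + ε) * q := by
    -- Here `(1 + ε) * q = 1 / L` suffices, since the gradient term is simply dropped.
    refine ⟨(1 / L - q) / q, div_pos (by linarith) hq0, ?_⟩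
    have : (1 + (1 / (L : ℝ) - q) / q) * q = 1 / L := by field_simp; ring
    rw [this, sub_self]
  have hg0 : ∀ x, 0 ≤ g x := fun x => hgu ▸ hu x
  set M := (1 + 1 / ε) * (2 * ‖gradient h u‖ ^ 2 + 2 * (Lh : ℝ) ^ 2 * R ^ 2) with hM
  have hM0 : 0 ≤ M := by positivity
  obtain ⟨K, hK⟩ := exists_sum_range_le (A := fun n => ‖X n - u‖ ^ 2)
    (t := fun n => 2 * (a n * (∑ i, φ n i + h (X n)) - a n * (∑ i, w i + h u)))
    (r := fun n => M * a n ^ 2) (fun n => sq_nonneg _) (fun n => by positivity)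
    (ha2.mul_left M) (by
      filter_upwards [habq] with n hn
      have h1 := iteration_norm_sq_le hf hh hhd hc hg hL0 hL hu hgu (hX.a_pos n) (hs n) hn hε
        (hX.start n) (hX.step n) (hφ n) hw
      rw [← hX.next, Finset.sum_sub_distrib] at h1
      have h2 : 0 ≤ ∑ i : Fin m, ‖Ψ n (i + 1) - Ψ n i‖ ^ 2 :=
        Finset.sum_nonneg fun i _ => sq_nonneg _
      have h3 := mul_nonneg (hs n).le (hg0 (X n))
      have h4 : 0 ≤ a n * b n * (1 / L - (1 + ε) * q) * ‖gradient g (X n)‖ ^ 2 :=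
        mul_nonneg (mul_nonneg (hs n).le hεq) (sq_nonneg _)
      have h5 : (1 + 1 / ε) * a n ^ 2 * ‖gradient h (X n)‖ ^ 2 ≤ M * a n ^ 2 := by
        have h6 : ‖X n - u‖ ^ 2 ≤ R ^ 2 := by gcongr; exact hR n
        have h7 : ‖gradient h (X n)‖ ^ 2 ≤ 2 * ‖gradient h u‖ ^ 2 + 2 * (Lh : ℝ) ^ 2 * R ^ 2 :=
          (sq_norm_gradient_le_of_lipschitz hLh (X n) u).trans (by gcongr)
        calc (1 + 1 / ε) * a n ^ 2 * ‖gradient h (X n)‖ ^ 2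
            ≤ (1 + 1 / ε) * a n ^ 2 * (2 * ‖gradient h u‖ ^ 2 + 2 * (Lh : ℝ) ^ 2 * R ^ 2) := by
              gcongr
          _ = M * a n ^ 2 := by rw [hM]; ring
      linarith)
  refine ⟨K / 2, fun N => ?_⟩
  have h1 := hK N
  rw [← Finset.mul_sum, Finset.sum_sub_distrib, ← Finset.sum_mul] at h1
  linarith

end Run


/-! ### Weak limits. -/

section Weak

variable {H : Type*} [NormedAddCommGroup H] [InnerProductSpace ℝ H] [CompleteSpace H]

/-- Banach–Alaoglu through the Riesz isomorphism; ultrafilters play the role of subsequences. -/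
theorem exists_weak_limit {κ : Type*} (U : Ultrafilter κ) {z : κ → H} {R : ℝ}
    (hR : ∀ n, ‖z n‖ ≤ R) :
    ∃ z₀ : H, ∀ y, Tendsto (fun n => inner ℝ (z n) y) U (𝓝 (inner ℝ z₀ y)) := by
  set T : κ → WeakDual ℝ H := fun n => StrongDual.toWeakDual (InnerProductSpace.toDual ℝ H (z n))
    with hT
  have hK := WeakDual.isCompact_closedBall (𝕜 := ℝ) (E := H) 0 R
  obtain ⟨x', -, hx'⟩ := isCompact_iff_ultrafilter_le_nhds.1 hK (U.map T) (by
    refine le_principal_iff.2 (Filter.mem_map.2 (Filter.Eventually.of_forall fun n => ?_))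
    simpa [hT] using hR n)
  refine ⟨(InnerProductSpace.toDual ℝ H).symm (WeakDual.toStrongDual x'), fun y => ?_⟩
  have h1 : Tendsto T U (𝓝 x') := hx'
  have h2 := ((WeakDual.eval_continuous y).tendsto x').comp h1
  rw [InnerProductSpace.toDual_symm_apply]
  exact h2

theorem mem_of_weak_limit {κ : Type*} {l : Filter κ} {z : κ → H} {z₀ : H}
    (hz : ∀ y, Tendsto (fun n => inner ℝ (z n) y) l (𝓝 (inner ℝ z₀ y))) {K : Set H}
    (hK : Convex ℝ K) (hKc : IsClosed K) (hmem : ∃ᶠ n in l, z n ∈ K) : z₀ ∈ K := by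
  by_contra hz₀
  obtain ⟨φ, s, hφ, hs⟩ := geometric_hahn_banach_point_closed hK hKc hz₀
  have hrep : ∀ x, inner ℝ x ((InnerProductSpace.toDual ℝ H).symm φ) = φ x := fun x => by
    rw [real_inner_comm, InnerProductSpace.toDual_symm_apply]
  have h1 := hz ((InnerProductSpace.toDual ℝ H).symm φ)
  simp only [hrep] at h1
  obtain ⟨n, hn1, hn2⟩ := (hmem.and_eventually (h1.eventually (gt_mem_nhds hφ))).exists
  exact lt_asymm (hs _ hn1) hn2

theorem tendsto_toWeakSpace {κ : Type*} {l : Filter κ} {z : κ → H} {z₀ : H}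
    (hz : ∀ y, Tendsto (fun n => inner ℝ (z n) y) l (𝓝 (inner ℝ z₀ y))) :
    Tendsto (fun n => toWeakSpace ℝ H (z n)) l (𝓝 (toWeakSpace ℝ H z₀)) := by
  refine (WeakBilin.tendsto_iff_forall_eval_tendsto (topDualPairing ℝ H).flip ?_).2 fun φ => ?_
  · intro x y hxy
    refine ext_inner_left ℝ fun v => ?_
    exact DFunLike.congr_fun hxy (InnerProductSpace.toDual ℝ H v)
  · have hrep : ∀ x, inner ℝ x ((InnerProductSpace.toDual ℝ H).symm φ) = φ x := fun x => by
      rw [real_inner_comm, InnerProductSpace.toDual_symm_apply]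
    have h1 := hz ((InnerProductSpace.toDual ℝ H).symm φ)
    simp only [hrep] at h1
    exact h1

end Weak

/-! ### Weighted averages. -/

section Average

/-- The weighted average of the first `N` terms of `Y`. -/
noncomputable def avg {E : Type*} [AddCommGroup E] [Module ℝ E] (a : ℕ → ℝ) (Y : ℕ → E) (N : ℕ) : E :=
  (∑ n ∈ Finset.range N, a n)⁻¹ • ∑ n ∈ Finset.range N, a n • Y n

theorem avg_add {E : Type*} [AddCommGroup E] [Module ℝ E] (a : ℕ → ℝ) (Y Z : ℕ → E) (N : ℕ) :
    avg a (fun n => Y n + Z n) N = avg a Y N + avg a Z N := by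
  simp only [avg, smul_add, Finset.sum_add_distrib]

theorem map_avg {E F : Type*} [AddCommGroup E] [Module ℝ E] [AddCommGroup F] [Module ℝ F]
    (φ : E →ₗ[ℝ] F) (a : ℕ → ℝ) (Y : ℕ → E) (N : ℕ) :
    φ (avg a Y N) = avg a (fun n => φ (Y n)) N := by
  simp only [avg, map_smul, map_sum]

theorem sum_range_pos {a : ℕ → ℝ} (ha : ∀ n, 0 < a n) {N : ℕ} (hN : 0 < N) :
    0 < ∑ n ∈ Finset.range N, a n :=
  Finset.sum_pos (fun n _ => ha n) (Finset.nonempty_range_iff.2 hN.ne')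

theorem avg_const {E : Type*} [AddCommGroup E] [Module ℝ E] {a : ℕ → ℝ} (ha : ∀ n, 0 < a n)
    {N : ℕ} (hN : 0 < N) (y : E) : avg a (fun _ => y) N = y := by
  rw [avg, ← Finset.sum_smul, inv_smul_smul₀ (sum_range_pos ha hN).ne']

theorem avg_mem {E : Type*} [AddCommGroup E] [Module ℝ E] {a : ℕ → ℝ} (ha : ∀ n, 0 < a n)
    {K : Set E} (hK : Convex ℝ K) {Y : ℕ → E} (hY : ∀ n, Y n ∈ K) {N : ℕ} (hN : 0 < N) :
    avg a Y N ∈ K :=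
  hK.centerMass_mem (fun n _ => (ha n).le) (sum_range_pos ha hN) fun n _ => hY n

theorem avg_mono {a : ℕ → ℝ} (ha : ∀ n, 0 < a n) {s t : ℕ → ℝ} (hst : ∀ n, s n ≤ t n) (N : ℕ) :
    avg a s N ≤ avg a t N := by
  refine mul_le_mul_of_nonneg_left (Finset.sum_le_sum fun n _ => ?_)
    (inv_nonneg.2 (Finset.sum_nonneg fun n _ => (ha n).le))
  exact mul_le_mul_of_nonneg_left (hst n) (ha n).le

theorem norm_avg_le {E : Type*} [NormedAddCommGroup E] [NormedSpace ℝ E] {a : ℕ → ℝ}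
    (ha : ∀ n, 0 < a n) {Y : ℕ → E} {R : ℝ} (hR : ∀ n, ‖Y n‖ ≤ R) (N : ℕ) : ‖avg a Y N‖ ≤ R := by
  rcases N.eq_zero_or_pos with rfl | hN
  · simpa [avg] using (norm_nonneg _).trans (hR 0)
  · simpa using avg_mem ha (convex_closedBall (0 : E) R) (fun n => by simpa using hR n) hN

/-- Weighted Cesàro limit; divergence of the weights makes any initial segment negligible. -/
theorem tendsto_avg_zero {E : Type*} [NormedAddCommGroup E] [NormedSpace ℝ E] {a : ℕ → ℝ}
    (ha : ∀ n, 0 < a n) (hsum : Tendsto (fun N => ∑ n ∈ Finset.range N, a n) atTop atTop)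
    {Y : ℕ → E} (hY : Tendsto Y atTop (𝓝 0)) : Tendsto (avg a Y) atTop (𝓝 0) := by
  have h1 : (fun n => a n • Y n) =o[atTop] a := by
    have := (Asymptotics.isBigO_refl a atTop).smul_isLittleO
      ((Asymptotics.isLittleO_one_iff ℝ).2 hY)
    simpa using this
  have h2 := (h1.sum_range (fun n => (ha n).le) hsum).tendsto_inv_smul_nhds_zero
  exact h2

theorem tendsto_avg {a : ℕ → ℝ}
    (ha : ∀ n, 0 < a n) (hsum : Tendsto (fun N => ∑ n ∈ Finset.range N, a n) atTop atTop)
    {Y : ℕ → ℝ} {y : ℝ} (hY : Tendsto Y atTop (𝓝 y)) : Tendsto (avg a Y) atTop (𝓝 y) := by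
  have h1 := tendsto_avg_zero ha hsum (Y := fun n => Y n - y) (by simpa using hY.sub_const y)
  have h2 := h1.add_const y
  rw [zero_add] at h2
  refine h2.congr' ?_
  filter_upwards [eventually_gt_atTop 0] with N hN
  nth_rw 2 [← avg_const ha hN y]
  rw [← avg_add]
  simp

theorem weightedAvg_eq_avg {H : Type*} [NormedAddCommGroup H] [InnerProductSpace ℝ H] (α : ℕ → ℝ) (x : ℕ → H)
    (k : ℕ) :
    weightedAvg α x k = avg (fun n => α (n + 1)) (fun n => x (n + 1)) k := by
  rw [weightedAvg, avg, Finset.range_eq_Ico, Finset.sum_Ico_add' α 0 k 1,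
    Finset.sum_Ico_add' (fun n => α n • x n) 0 k 1]
  rfl

end Average

/-! ### Extended-real sums. -/

section EReal

theorem coe_finset_sum {ι : Type*} (s : Finset ι) (c : ι → ℝ) :
    ((∑ i ∈ s, c i : ℝ) : EReal) = ∑ i ∈ s, (c i : EReal) :=
  map_sum (⟨⟨Real.toEReal, EReal.coe_zero⟩, EReal.coe_add⟩ : ℝ →+ EReal) c s

/-- Lets lower semicontinuity be used one summand at a time, with real minorants, before the
summands are known to be finite. -/
theorem sum_le_coe_of_forall_lt {ι : Type*} [Fintype ι] {e : ι → EReal} (he : ∀ i, e i ≠ ⊥)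
    {B : ℝ} (hB : ∀ c : ι → ℝ, (∀ i, (c i : EReal) < e i) → ∑ i, c i ≤ B) :
    ∑ i, e i ≤ B := by
  classical
  have hlow : ∀ i, ∃ c : ℝ, (c : EReal) < e i := fun i => by
    obtain ⟨c, -, hc⟩ := EReal.lt_iff_exists_real_btwn.1 (bot_lt_iff_ne_bot.2 (he i))
    exact ⟨c, hc⟩
  choose c hc using hlow
  have htop : ∀ j, e j ≠ ⊤ := by
    intro j hj
    have h1 := hB (Function.update c j (B - ∑ i ∈ Finset.univ.erase j, c i + 1)) (fun i => by
      rcases eq_or_ne i j with rfl | hij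
      · rw [hj]; exact EReal.coe_lt_top _
      · simpa [hij] using hc i)
    rw [← Finset.add_sum_erase _ _ (Finset.mem_univ j)] at h1
    rw [Finset.sum_congr rfl (fun i hi => by
      rw [Function.update_of_ne (Finset.ne_of_mem_erase hi)] :
      ∀ i ∈ Finset.univ.erase j, Function.update c j
        (B - ∑ i ∈ Finset.univ.erase j, c i + 1) i = c i)] at h1
    simp only [Function.update_self] at h1
    linarith
  lift e to ι → ℝ using fun i => ⟨htop i, he i⟩
  change ∑ i, (e i : EReal) ≤ B
  rw [← coe_finset_sum, EReal.coe_le_coe_iff]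
  refine le_of_forall_pos_le_add fun ε hε => ?_
  have hN : (0 : ℝ) < Fintype.card ι + 1 := by positivity
  have h1 := hB (fun i => e i - ε / (Fintype.card ι + 1)) fun i =>
    EReal.coe_lt_coe_iff.2 (by linarith [div_pos hε hN])
  rw [Finset.sum_sub_distrib, Finset.sum_const, nsmul_eq_mul, Finset.card_univ] at h1
  have h2 : Fintype.card ι * (ε / (Fintype.card ι + 1)) ≤ ε := by
    rw [mul_div_assoc', div_le_iff₀ hN]
    nlinarith
  linarith

theorem ne_top_of_sum_ne_top {ι : Type*} [Fintype ι] {e : ι → EReal} (he : ∀ i, e i ≠ ⊥)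
    (hs : ∑ i, e i ≠ ⊤) (i : ι) : e i ≠ ⊤ := by
  classical
  intro hi
  refine hs ?_
  rw [← Finset.add_sum_erase _ _ (Finset.mem_univ i), hi]
  refine EReal.top_add_of_ne_bot ?_
  refine Finset.sum_induction _ (fun x => x ≠ ⊥) (fun x y hx hy => ?_) (by simp)
    fun j _ => he j
  simp [EReal.add_eq_bot_iff, hx, hy]

end EReal

/-! ### Cluster points, optimality conditions and uniqueness of the limit. -/

section Main

variable {H : Type*} [NormedAddCommGroup H] [InnerProductSpace ℝ H] [CompleteSpace H]

/-- Weak cluster points of the averages are solutions. -/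
theorem IsRun.mem_solutions {m : ℕ} {f : Fin m → H → EReal} {h g : H → ℝ} {a b : ℕ → ℝ}
    {X : ℕ → H} {Ψ : ℕ → ℕ → H} (hX : IsRun f h g a b X Ψ) (hfp : ∀ i, Proper (f i))
    (hf : ∀ i, ConvexFun (f i)) (hlsc : ∀ i, LowerSemicontinuous (f i))
    (hh : ConvexOn ℝ Set.univ h)
    (hhd : Differentiable ℝ h) (hc : ConvexOn ℝ Set.univ g) (hg : Differentiable ℝ g) {L Lh : ℝ≥0}
    (hL0 : 0 < L) (hL : LipschitzWith L (gradient g)) (hLh : LipschitzWith Lh (gradient h))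
    (hne : (argmin g).Nonempty) (hmin : ∀ x ∈ argmin g, g x = 0) {q : ℝ}
    (habq : ∀ᶠ n in atTop, a n * b n ≤ q) (hq : q < 1 / L)
    (ha2 : Summable fun n => a n ^ 2)
    (hsum : Tendsto (fun N => ∑ n ∈ Finset.range N, a n) atTop atTop)
    {R : ℝ} (hR : ∀ n, ‖X n‖ ≤ R) (hgX : Tendsto (fun n => g (X n)) atTop (𝓝 0))
    (hΨ : ∀ j ≤ m, Tendsto (fun n => Ψ n j - X n) atTop (𝓝 0))
    {U : Filter ℕ} [U.NeBot] (hU : U ≤ atTop) {z : H}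
    (hz : ∀ y, Tendsto (fun N => inner ℝ (avg a X N) y) U (𝓝 (inner ℝ z y))) :
    z ∈ solutions f h g := by
  have ha := hX.a_pos
  have hU0 : ∀ᶠ N in U, 0 < N := hU (eventually_gt_atTop 0)
  have hlin : ∀ v, Tendsto (fun N => inner ℝ v (avg a X N - z)) U (𝓝 0) := fun v => by
    have := (hz v).sub_const (inner ℝ z v)
    rw [sub_self] at this
    refine this.congr fun N => ?_
    rw [inner_sub_right, real_inner_comm v (avg a X N), real_inner_comm v z]
  -- Averaging the tangent inequality at `z` leaves only a linear term, which vanishes in the weak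
  -- limit.
  have hjensen : ∀ k : H → ℝ, ConvexOn ℝ Set.univ k → Differentiable ℝ k → ∀ N, 0 < N →
      k z + inner ℝ (gradient k z) (avg a X N - z) ≤ avg a (fun n => k (X n)) N := by
    intro k hk hkd N hN
    have h1 := avg_mono ha (fun n => add_inner_gradient_le hk hkd z (X n)) N
    rw [avg_add, avg_const ha hN] at h1
    have h2 : avg a (fun n => X n - z) N = avg a X N - z := by
      have h3 := avg_add a (fun n => X n - z) (fun _ => z) N
      simp only [sub_add_cancel, avg_const ha hN] at h3
      exact eq_sub_of_add_eq h3.symm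
    have h3 := map_avg (innerₛₗ ℝ (gradient k z)) a (fun n => X n - z) N
    rw [h2] at h3
    simp only [innerₛₗ_apply_apply] at h3
    linarith
  obtain ⟨c₀, hc₀⟩ := hne
  have hg0 : ∀ x, 0 ≤ g x := fun x => hmin c₀ hc₀ ▸ hc₀ x
  have hgz : g z ≤ 0 := by
    have h1 := (hlin (gradient g z)).const_add (g z)
    rw [add_zero] at h1
    refine le_of_tendsto_of_tendsto h1 ((tendsto_avg ha hsum hgX).mono_left hU) ?_
    filter_upwards [hU0] with N hN using hjensen g hc hg N hN
  refine ⟨fun y => hgz.trans (hg0 y), fun y hy => ?_⟩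
  by_cases hfin : ∑ i, f i y = ⊤
  · rw [hfin, EReal.top_add_coe]
    exact le_top
  have hyt := ne_top_of_sum_ne_top (fun i => (hfp i).1 y) hfin
  obtain ⟨w, hw⟩ : ∃ w : Fin m → ℝ, ∀ i, f i y = w i :=
    ⟨fun i => (f i y).toReal, fun i => (EReal.coe_toReal (hyt i) ((hfp i).1 y)).symm⟩
  choose φ hφ using fun n (i : Fin m) => (hX.step n i).exists_real (hfp i)
  obtain ⟨K, hK⟩ := hX.exists_sum_le hf hh hhd hc hg hL0 hL hLh hy (hmin y hy) habq hq ha2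
    (R := R + ‖y‖) (fun n => (norm_sub_le _ _).trans (by linarith [hR n])) hw hφ
  have hψz : ∀ i : Fin m, ∀ v,
      Tendsto (fun N => inner ℝ (avg a (fun n => Ψ n (i + 1)) N) v) U (𝓝 (inner ℝ z v)) := by
    intro i v
    have h1 := ((tendsto_avg_zero ha hsum (hΨ (i + 1) i.2)).mono_left hU).inner (𝕜 := ℝ)
      (tendsto_const_nhds (x := v))
    have h2 := h1.add (hz v)
    rw [inner_zero_left, zero_add] at h2
    refine h2.congr fun N => ?_
    rw [← inner_add_left, ← avg_add]
    simp
  have key : ∑ i, f i z ≤ ((∑ i, w i + h y - h z : ℝ) : EReal) := by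
    refine sum_le_coe_of_forall_lt (fun i => (hfp i).1 z) fun c hcz => ?_
    -- Otherwise, by Jensen on the epigraph, the averaged inner iterates would frequently lie in the
    -- closed convex set `f i ≤ c i`, which would then contain their weak limit `z`.
    have hev : ∀ i : Fin m, ∀ᶠ N in U, c i ≤ avg a (fun n => φ n i) N := by
      intro i
      by_contra hcon
      rw [not_eventually] at hcon
      refine absurd (mem_of_weak_limit (hψz i) ((hf i).convex_sublevel (c i))
        ((hlsc i).isClosed_preimage _) ?_) (not_le.2 (hcz i))
      refine (hcon.and_eventually hU0).mono fun N ⟨h1, hN⟩ => ?_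
      have h2 := avg_mem ha (hf i).convex_epigraph (Y := fun n => (Ψ n (i + 1), φ n i))
        (fun n => (hφ n i).le) hN
      have h3 := map_avg (LinearMap.fst ℝ H ℝ) a (fun n => (Ψ n (i + 1), φ n i)) N
      have h4 := map_avg (LinearMap.snd ℝ H ℝ) a (fun n => (Ψ n (i + 1), φ n i)) N
      simp only [LinearMap.fst_apply, LinearMap.snd_apply] at h3 h4
      rw [Set.mem_ofPred_eq, h3, h4] at h2
      exact h2.trans (EReal.coe_le_coe_iff.2 (not_le.1 h1).le)
    have h1 : ∀ᶠ N in U, ∑ i, c i + (h z + inner ℝ (gradient h z) (avg a X N - z))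
        ≤ (∑ n ∈ Finset.range N, a n)⁻¹ * K + (∑ i, w i + h y) := by
      filter_upwards [eventually_all.2 hev, hU0] with N hN hN0
      have hτ := sum_range_pos ha hN0
      have h2 := Finset.sum_le_sum fun i (_ : i ∈ Finset.univ) => hN i
      have h3 := hjensen h hh hhd N hN0
      have h4 : ∑ i, avg a (fun n => φ n i) N + avg a (fun n => h (X n)) N
          = (∑ n ∈ Finset.range N, a n)⁻¹ *
            ∑ n ∈ Finset.range N, a n * (∑ i, φ n i + h (X n)) := by
        simp only [avg, smul_eq_mul]
        rw [← Finset.mul_sum, Finset.sum_comm, ← mul_add, ← Finset.sum_add_distrib]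
        simp only [mul_add, Finset.mul_sum]
      have h5 := mul_le_mul_of_nonneg_left (hK N) (inv_nonneg.2 hτ.le)
      rw [mul_add, inv_mul_cancel_left₀ hτ.ne'] at h5
      linarith
    have h2 := ((hlin (gradient h z)).const_add (h z)).const_add (∑ i, c i)
    have h3 := (((tendsto_inv_atTop_zero.comp hsum).mono_left hU).mul_const K).add_const
      (∑ i, w i + h y)
    have h4 := le_of_tendsto_of_tendsto h2 h3 h1
    linarith
  have hsw : ∑ i, f i y = ((∑ i, w i : ℝ) : EReal) := by
    rw [coe_finset_sum]
    exact Finset.sum_congr rfl fun i _ => hw i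
  rw [hsw, ← EReal.coe_add]
  refine (add_le_add_left key _).trans (le_of_eq ?_)
  rw [← EReal.coe_add, sub_add_cancel]

/-- Optimality conditions at a solution, under the interiority qualification condition. -/
theorem exists_subgradients_of_mem_solutions {m : ℕ} {f : Fin m → H → EReal} {h g : H → ℝ}
    (hfp : ∀ i, Proper (f i)) (hf : ∀ i, ConvexFun (f i)) (hlsc : ∀ i, LowerSemicontinuous (f i))
    (hh : ConvexOn ℝ Set.univ h) (hhc : Continuous h) (hc : ConvexOn ℝ Set.univ g)
    (S1 : (argmin g ∩ ⋂ i, interior (domSubdiff (f i))).Nonempty)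
    {u : H} (hu : u ∈ solutions f h g) :
    ∃ (w : Fin m → ℝ) (v : Fin m → H) (v₀ : H), (∀ i, f i u = w i) ∧
      (∀ i y (r : ℝ), f i y ≤ r → w i + inner ℝ (v i) (y - u) ≤ r) ∧
      (∀ y, h u + inner ℝ v₀ (y - u) ≤ h y) ∧
      ∀ c ∈ argmin g, 0 ≤ inner ℝ (∑ i, v i + v₀) (c - u) := by
  obtain ⟨x₀, hx₀, hx₀'⟩ := S1
  rw [Set.mem_iInter] at hx₀'
  have hdom : ∀ i, ∀ y ∈ domSubdiff (f i), f i y ≠ ⊤ := fun i y ⟨v, hv⟩ => hv.2.1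
  have hx₀t : ∀ i, f i x₀ ≠ ⊤ := fun i => hdom i _ (interior_subset (hx₀' i))
  have hut : ∀ i, f i u ≠ ⊤ := by
    refine ne_top_of_sum_ne_top (fun i => (hfp i).1 u) fun htop => ?_
    have h1 := hu.2 x₀ hx₀
    rw [htop, EReal.top_add_coe, top_le_iff] at h1
    have h2 : ∑ i, f i x₀ = ((∑ i, (f i x₀).toReal : ℝ) : EReal) := by
      rw [coe_finset_sum]
      exact Finset.sum_congr rfl fun i _ => (EReal.coe_toReal (hx₀t i) ((hfp i).1 _)).symm
    rw [h2, ← EReal.coe_add] at h1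
    exact EReal.coe_ne_top _ h1
  obtain ⟨w, hw⟩ : ∃ w : Fin m → ℝ, ∀ i, f i u = w i :=
    ⟨fun i => (f i u).toReal, fun i => (EReal.coe_toReal (hut i) ((hfp i).1 u)).symm⟩
  -- The index `none` adds `h` as one more summand.
  set F : Option (Fin m) → H → EReal := fun o => o.elim (fun x => (h x : EReal)) f with hF
  set W : Option (Fin m) → ℝ := fun o => o.elim (h u) w with hW
  obtain ⟨v, hv, hvC⟩ := exists_subgradients_of_isMin (F := F) (w := W) (C := argmin g) (x₀ := x₀)
    (u := u) (by rintro (_ | i); exacts [ConvexFun.coe hh, hf i]) (convex_argmin hc) hx₀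
    (by
      rintro (_ | i)
      · refine ⟨h x₀ + 1, ?_⟩
        filter_upwards [hhc.continuousAt.eventually (gt_mem_nhds (lt_add_one (h x₀)))]
          with y hy using EReal.coe_le_coe_iff.2 hy.le
      · exact exists_eventually_le_of_mem_interior (hf i) (hlsc i) (hdom i) (hx₀' i))
    hu.1 (by rintro (_ | i); exacts [rfl, hw i])
    (by
      intro c hcC r hr
      rw [← EReal.coe_le_coe_iff, Fintype.sum_option, Fintype.sum_option, add_comm,
        add_comm (r none), EReal.coe_add, EReal.coe_add, coe_finset_sum,
        coe_finset_sum]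
      have h1 := hu.2 c hcC
      simp only [hw] at h1
      refine h1.trans (add_le_add (Finset.sum_le_sum fun i _ => hr (some i)) (hr none)))
  refine ⟨w, fun i => v (some i), v none, hw, fun i y r => hv (some i) y r,
    fun y => hv none y (h y) le_rfl, fun c hcC => ?_⟩
  have h1 := hvC c hcC
  rwa [Fintype.sum_option, ← sum_inner, add_comm, ← inner_add_left] at h1

/-- Convergence of the distances to a solution. -/
theorem IsRun.tendsto_of_mem_solutions {m : ℕ} {f : Fin m → H → EReal} {h g : H → ℝ} {a b : ℕ → ℝ}
    {X : ℕ → H} {Ψ : ℕ → ℕ → H} (hX : IsRun f h g a b X Ψ) (hfp : ∀ i, Proper (f i))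
    (hf : ∀ i, ConvexFun (f i)) (hlsc : ∀ i, LowerSemicontinuous (f i))
    (hh : ConvexOn ℝ Set.univ h)
    (hhd : Differentiable ℝ h) (hc : ConvexOn ℝ Set.univ g) (hg : Differentiable ℝ g) {L Lh : ℝ≥0}
    (hL0 : 0 < L) (hL : LipschitzWith L (gradient g)) (hLh : LipschitzWith Lh (gradient h))
    (hmin : ∀ x ∈ argmin g, g x = 0) {l q : ℝ} (hl : 0 < l)
    (hlab : ∀ᶠ n in atTop, l ≤ a n * b n)
    (habq : ∀ᶠ n in atTop, a n * b n ≤ q) (hq : q < 1 / L)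
    (ha2 : Summable fun n => a n ^ 2)
    (S1 : (argmin g ∩ ⋂ i, interior (domSubdiff (f i))).Nonempty)
    (S2 : ∀ p ∈ ranNormalCone (argmin g), ∑' n : ℕ, penaltyTerm g (a n) (b n) p < ⊤)
    {u : H} (hu : u ∈ solutions f h g) :
    (∃ r, Tendsto (fun n => ‖X n - u‖ ^ 2) atTop (𝓝 r)) ∧ Tendsto (fun n => g (X n)) atTop (𝓝 0) ∧
      ∀ j ≤ m, Tendsto (fun n => Ψ n j - X n) atTop (𝓝 0) := by
  obtain ⟨w, v, v₀, hw, hv, hv₀, hvC⟩ :=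
    exists_subgradients_of_mem_solutions hfp hf hlsc hh hhd.continuous hc S1 hu
  set p : H := -(∑ i, v i + v₀) with hp
  -- The factor `2` matches `2 * a n` in the one-step estimate.
  have hpC : (2 : ℝ) • p ∈ normalCone (argmin g) u := by
    refine ⟨hu.1, fun z hz => ?_⟩
    have h1 := hvC z hz
    rw [real_inner_smul_left, hp, inner_neg_left]
    linarith
  have hs := (S2 _ ⟨u, hpC⟩).ne
  obtain ⟨N, hN⟩ := eventually_atTop.1 (hlab.and habq)
  have hθs := (summable_nat_add_iff
    (f := fun n => (penaltyTerm g (a n) (b n) ((2 : ℝ) • p)).toReal) N).2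
    (ENNReal.summable_toReal hs)
  have key := (hX.shift N).fejer hfp hf hh hhd hc hg hL0 hL hLh hu.1 (hmin u hu.1) hl
    (fun n => (hN _ (Nat.le_add_left N n)).1) (fun n => (hN _ (Nat.le_add_left N n)).2) hq
    ((summable_nat_add_iff (f := fun n => a n ^ 2) N).2 ha2) hw hv hv₀
    (θ := fun n => (penaltyTerm g (a (n + N)) (b (n + N)) ((2 : ℝ) • p)).toReal)
    (fun n => ENNReal.toReal_nonneg)
    hθs (fun n => by
      have h1 := penaltyTerm_ge (hX.a_pos (n + N)) (hX.b_pos (n + N)) hpC (X (n + N))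
      rw [ENNReal.ofReal_le_iff_le_toReal (ENNReal.ne_top_of_tsum_ne_top hs _),
        real_inner_smul_left] at h1
      linarith)
  obtain ⟨⟨r, h1⟩, h2, h3⟩ := key
  refine ⟨⟨r, ?_⟩, ?_, fun j hj => ?_⟩
  · exact (tendsto_add_atTop_iff_nat (f := fun n => ‖X n - u‖ ^ 2) N).1 h1
  · exact (tendsto_add_atTop_iff_nat (f := fun n => g (X n)) N).1 h2
  · exact (tendsto_add_atTop_iff_nat (f := fun n => Ψ n j - X n) N).1 (h3 j hj)

/-- The Opial–Passty lemma: weak ergodic convergence. -/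
theorem tendsto_avg_weakly {a : ℕ → ℝ} (ha : ∀ n, 0 < a n)
    (hsum : Tendsto (fun N => ∑ n ∈ Finset.range N, a n) atTop atTop) {X : ℕ → H} {S : Set H}
    (hdist : ∀ u ∈ S, ∃ r, Tendsto (fun n => ‖X n - u‖ ^ 2) atTop (𝓝 r))
    (hclus : ∀ (U : Ultrafilter ℕ) (z : H), (U : Filter ℕ) ≤ atTop →
      (∀ y, Tendsto (fun N => inner ℝ (avg a X N) y) U (𝓝 (inner ℝ z y))) → z ∈ S)
    {R : ℝ} (hR : ∀ n, ‖X n‖ ≤ R) :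
    ∃ z ∈ S, ∀ y, Tendsto (fun N => inner ℝ (avg a X N) y) atTop (𝓝 (inner ℝ z y)) := by
  have hex := fun U : Ultrafilter ℕ => exists_weak_limit U (norm_avg_le ha hR)
  obtain ⟨z, hz⟩ := hex (Ultrafilter.of atTop)
  have hzS := hclus _ z (Ultrafilter.of_le _) hz
  refine ⟨z, hzS, fun y => (tendsto_iff_ultrafilter _ _ _).2 fun U hU => ?_⟩
  obtain ⟨z', hz'⟩ := hex U
  have hzS' := hclus U z' hU hz'
  obtain ⟨r, hr⟩ := hdist z hzS
  obtain ⟨r', hr'⟩ := hdist z' hzS'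
  -- The difference of the squared distances to `z'` and `z` is affine in `X n`. Hence `⟨X n, z -
  -- z'⟩` and its averages have one limit, which must equal both `⟨z, z - z'⟩` and `⟨z', z - z'⟩`.
  have h1 : Tendsto (fun n => inner ℝ (X n) (z - z')) atTop
      (𝓝 ((r' - r + (‖z‖ ^ 2 - ‖z'‖ ^ 2)) / 2)) := by
    refine (((hr'.sub hr).add_const (‖z‖ ^ 2 - ‖z'‖ ^ 2)).div_const 2).congr fun n => ?_
    rw [norm_sub_sq_real, norm_sub_sq_real, inner_sub_right]
    ring
  have h2 : Tendsto (fun N => inner ℝ (avg a X N) (z - z')) atTop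
      (𝓝 ((r' - r + (‖z‖ ^ 2 - ‖z'‖ ^ 2)) / 2)) := by
    refine (tendsto_avg ha hsum h1).congr fun N => ?_
    have := map_avg (innerₛₗ ℝ (z - z')) a X N
    simp only [innerₛₗ_apply_apply] at this
    rw [real_inner_comm, this]
    simp only [real_inner_comm]
  have h3 := tendsto_nhds_unique (hz (z - z')) (h2.mono_left (Ultrafilter.of_le _))
  have h4 := tendsto_nhds_unique (hz' (z - z')) (h2.mono_left hU)
  have h5 : inner ℝ (z - z') (z - z') = 0 := by rw [inner_sub_left, h3, h4, sub_self]
  rw [sub_eq_zero.1 (inner_self_eq_zero.1 h5)]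
  exact hz' y

end Main

end HierMin

theorem corollary4p1
    {H : Type*} [NormedAddCommGroup H] [InnerProductSpace ℝ H] [CompleteSpace H]
    -- the data of the problem
    {m : ℕ} (hm : 1 ≤ m) (f : Fin m → H → EReal) (h g : H → ℝ)
    (hf_proper : ∀ i, HierMin.Proper (f i))
    (hf_convex : ∀ i, HierMin.ConvexFun (f i))
    (hf_lsc : ∀ i, LowerSemicontinuous (f i))
    (hh_convex : ConvexOn ℝ Set.univ h) (hh_diff : Differentiable ℝ h)
    (hg_convex : ConvexOn ℝ Set.univ g) (hg_diff : Differentiable ℝ g)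
    (Lh Lg : ℝ≥0) (hLg : 0 < Lg)
    (hh_lip : LipschitzWith Lh (gradient h)) (hg_lip : LipschitzWith Lg (gradient g))
    (hg_argmin : (HierMin.argmin g).Nonempty) (hg_min : ∀ x ∈ HierMin.argmin g, g x = 0)
    (hS : (HierMin.solutions f h g).Nonempty)
    -- the algorithm
    (α β : ℕ → ℝ) (hα : ∀ k, 1 ≤ k → 0 < α k) (hβ : ∀ k, 1 ≤ k → 0 < β k)
    (x : ℕ → H) (ψ : ℕ → ℕ → H) (hx : HierMin.IsGenerated f h g α β x ψ)
    -- (S1)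
    (S1 : (HierMin.argmin g ∩ ⋂ i, interior (HierMin.domSubdiff (f i))).Nonempty)
    -- (S2)
    (S2 : ∀ p ∈ HierMin.ranNormalCone (HierMin.argmin g),
      ∑' k : ℕ, HierMin.penaltyTerm g (α (k + 1)) (β (k + 1)) p < ⊤)
    -- (S3)
    (S3_liminf : (0 : EReal) < liminf (fun k => ((α k * β k : ℝ) : EReal)) atTop)
    (S3_limsup : limsup (fun k => ((α k * β k : ℝ) : EReal)) atTop
      < ((1 / (Lg : ℝ) : ℝ) : EReal))
    -- (S4)
    (S4_sq : Summable (fun k => α k ^ 2)) (S4_not : ¬ Summable α) :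
    ∃ xbar ∈ HierMin.solutions f h g,
      Tendsto (fun k => toWeakSpace ℝ H (HierMin.weightedAvg α x k)) atTop
        (𝓝 (toWeakSpace ℝ H xbar)) := by

  have hLg' : (0 : ℝ) < Lg := hLg
  obtain ⟨l, hl0, hl⟩ := EReal.lt_iff_exists_real_btwn.1 S3_liminf
  obtain ⟨q, hq, hq1⟩ := EReal.lt_iff_exists_real_btwn.1 S3_limsup
  have hlab : ∀ᶠ k in atTop, l ≤ α k * β k := by
    filter_upwards [eventually_lt_of_lt_liminf hl] with k hk using (EReal.coe_lt_coe_iff.1 hk).le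
  have habq : ∀ᶠ k in atTop, α k * β k ≤ q := by
    filter_upwards [eventually_lt_of_limsup_lt hq] with k hk using (EReal.coe_lt_coe_iff.1 hk).le
  have hX := hx.isRun hα hβ
  have hsum : Tendsto (fun N => ∑ n ∈ Finset.range N, α (n + 1)) atTop atTop := by
    rw [← not_summable_iff_tendsto_nat_atTop_of_nonneg fun n => (hX.a_pos n).le]
    exact fun hs => S4_not ((summable_nat_add_iff 1).1 hs)
  have hsq := (summable_nat_add_iff 1).2 S4_sq
  have habq' := (tendsto_add_atTop_nat 1).eventually habq
  have hconv := fun u => hX.tendsto_of_mem_solutions (u := u) hf_proper hf_convex hf_lsc hh_convex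
    hh_diff hg_convex hg_diff hLg hg_lip hh_lip hg_min (EReal.coe_pos.1 hl0)
    ((tendsto_add_atTop_nat 1).eventually hlab) habq' (EReal.coe_lt_coe_iff.1 hq1) hsq S1 S2
  obtain ⟨u, hu⟩ := hS
  obtain ⟨⟨r, hr⟩, hgX, hΨ⟩ := hconv u hu
  -- A convergent distance to a single solution bounds the iterates.
  obtain ⟨R, hR⟩ : ∃ R, ∀ n, ‖x (n + 1)‖ ≤ R := by
    obtain ⟨M, hM⟩ := hr.sqrt.bddAbove_range
    refine ⟨M + ‖u‖, fun n => ?_⟩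
    have h1 := hM ⟨n, rfl⟩
    simp only [Real.sqrt_sq (norm_nonneg _)] at h1
    have h2 := norm_add_le (x (n + 1) - u) u
    rw [sub_add_cancel] at h2
    linarith
  obtain ⟨z, hz, hlim⟩ := HierMin.tendsto_avg_weakly hX.a_pos hsum
    (fun v hv => (hconv v hv).1)
    (fun U z hU hUz => hX.mem_solutions hf_proper hf_convex hf_lsc hh_convex hh_diff hg_convex
      hg_diff hLg hg_lip hh_lip hg_argmin hg_min habq' (EReal.coe_lt_coe_iff.1 hq1) hsq hsum hR hgX
      hΨ hU hUz) hR
  refine ⟨z, hz, ?_⟩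
  simp only [HierMin.weightedAvg_eq_avg]
  exact HierMin.tendsto_toWeakSpace hlim
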